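/- Let $D\ge 2$ and let $\Sigma\in\mathbb R^{D\times D}$ be a symmetric positive semidefinite matrix with $\operatorname{tr}\Sigma=D$ and pairwise distinct eigenvalues. Let $L\ge 0$ and let $Q_1,\dots,Q_L$ be independent random rotations, each distributed according to the normalized Haar measure on the orthogonal group $O(D)$. A Gaussianization block with rotation $Q$ is a map $x\mapsto \big(f_i((Qx)_i)\big)_{i=1,\dots,D}$ on $\mathbb R^D$, where each one-dimensional transform $f_i:\mathbb R\to\mathbb R$ is a homeomorphism, linear or not, with linear tails: $f_i(t)/t$ has a finite nonzero limit as $t\to+\infty$ and a finite nonzero limit as $t\to-\infty$ (this includes all invertible affine maps and all continuous invertible splines with non-constant affine tails). Then the following holds almost surely with respect to $(Q_1,\dots,Q_L)$: if there is any choice of such transforms in each of the $L$ layers for which the composition of the $L$ blocks with rotations $Q_1,\dots,Q_L$ maps the distribution $\mathcal N(0,\Sigma)$ exactly to $\mathcal N(0,I)$, then $$L\ \ge\ \frac{D+1}{2}.$$ -/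

import Mathlib

open MeasureTheory ProbabilityTheory Filter Topology Matrix

/-- The orthogonal group `O(D)`, carrying its Borel σ-algebra. -/
instance orthogonalGroup_measurableSpace (D : ℕ) :
    MeasurableSpace (Matrix.orthogonalGroup (Fin D) ℝ) := borel _

instance orthogonalGroup_borelSpace (D : ℕ) :
    BorelSpace (Matrix.orthogonalGroup (Fin D) ℝ) := ⟨rfl⟩

/-- `O(D)` is compact. -/
instance orthogonalGroup_compactSpace (D : ℕ) :
    CompactSpace (Matrix.orthogonalGroup (Fin D) ℝ) := by
  have hc : IsClosed {A : Matrix (Fin D) (Fin D) ℝ | A * Aᵀ = 1} :=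
    isClosed_eq (by fun_prop) continuous_const
  have hK : IsCompact (Set.pi Set.univ fun _ : Fin D =>
      Set.pi Set.univ fun _ : Fin D => Set.Icc (-1 : ℝ) 1) :=
    isCompact_univ_pi fun _ => isCompact_univ_pi fun _ => isCompact_Icc
  have hset : ((Matrix.orthogonalGroup (Fin D) ℝ : Submonoid (Matrix (Fin D) (Fin D) ℝ)) :
      Set (Matrix (Fin D) (Fin D) ℝ)) = {A | A * Aᵀ = 1} := by
    ext A
    exact Matrix.mem_orthogonalGroup_iff _ _
  refine isCompact_iff_compactSpace.mp
    (IsCompact.of_isClosed_subset hK (hset ▸ hc) fun A hA i _ j _ => ?_)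
  exact abs_le.mp (entry_norm_bound_of_unitary hA i j)

/-- The normalized Haar measure on `O(D)`: the law of a random rotation. -/
noncomputable def haarOrthogonal (D : ℕ) : Measure (Matrix.orthogonalGroup (Fin D) ℝ) :=
  Measure.haarMeasure ⊤

instance haarOrthogonal_isProbabilityMeasure (D : ℕ) :
    IsProbabilityMeasure (haarOrthogonal D) :=
  ⟨Measure.haarMeasure_self⟩

/-- A function `f : ℝ → ℝ` has linear tails if it grows linearly towards `+∞` and towards `-∞`:
`f t / t` has finite, nonzero limits there (the two limits may differ). -/
def HasLinearTails (f : ℝ → ℝ) : Prop :=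
  (∃ a : ℝ, a ≠ 0 ∧ Tendsto (fun t => f t / t) atTop (𝓝 a)) ∧
    (∃ b : ℝ, b ≠ 0 ∧ Tendsto (fun t => f t / t) atBot (𝓝 b))

/-- A Gaussianization block: the rotation `x ↦ Q x` followed by a dimension-wise transform,
`x ↦ (fᵢ((Q x)ᵢ))ᵢ`. -/
noncomputable def gaussianizationBlock {D : ℕ} (Q : Matrix.orthogonalGroup (Fin D) ℝ)
    (f : Fin D → ℝ ≃ₜ ℝ) (x : EuclideanSpace ℝ (Fin D)) : EuclideanSpace ℝ (Fin D) :=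
  WithLp.toLp 2 fun i => f i (((Q : Matrix (Fin D) (Fin D) ℝ) *ᵥ x.ofLp) i)

/-- The composition of `L` Gaussianization blocks; block `0` is applied first. -/
noncomputable def gaussianization {D : ℕ} : (L : ℕ) →
    (Fin L → Matrix.orthogonalGroup (Fin D) ℝ) → (Fin L → Fin D → ℝ ≃ₜ ℝ) →
    EuclideanSpace ℝ (Fin D) → EuclideanSpace ℝ (Fin D)
  | 0, _, _ => id
  | L + 1, Q, f => gaussianizationBlock (Q (Fin.last L)) (f (Fin.last L)) ∘
      gaussianization L (fun l => Q l.castSucc) (fun l => f l.castSucc)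

/-- The distribution `p` is exactly represented by Gaussianization with the rotations
`Q 0, …, Q (L - 1)`: for some choice of invertible one-dimensional transforms with linear tails,
one for each layer and each dimension, the latent codes of data distributed according to `p`
are exactly standard normal. -/
def ExactlyRepresentable {D L : ℕ} (p : Measure (EuclideanSpace ℝ (Fin D)))
    (Q : Fin L → Matrix.orthogonalGroup (Fin D) ℝ) : Prop :=
  ∃ f : Fin L → Fin D → ℝ ≃ₜ ℝ, (∀ l i, HasLinearTails (f l i)) ∧
    p.map (gaussianization L Q f) = stdGaussian (EuclideanSpace ℝ (Fin D))

/-! Nonlinear transforms gain nothing over linear ones. Let `R = √Σ`, so that a representing map `Φ`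
makes `Φ ∘ R` preserve the standard Gaussian, and look at `Φ` from infinity. Linear tails make the
limit of `Φ (t x) / t` piecewise linear; its finitely many pieces are products of the rotations and
of diagonal matrices of tail slopes. Unit cubes near `t x` have Gaussian mass about `exp (-t² ‖x‖² /
2)`, so the blow-down of a measure-preserving map cannot increase norms
(`HasBlowdown.norm_le_of_map_stdGaussian`). Applied to the map and to its inverse, this gives norm
preservation. By Baire, one linear piece preserves norms on a nonempty open set, hence everywhere,
and it provides a matrix `M` of layers with `M Σ Mᵀ = 1`.

For linear layers, count parameters. Inverting `M` gives `Σ = N Nᵀ`. After conjugation with the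
first rotation, the first diagonal matrix only rescales coordinates, so the correlations of `Q₀ Σ
Q₀ᵀ` are, up to signs, a `C¹` function of the remaining `(L - 1) D` scales. They fill only a null
set of `ℝ^(D (D - 1) / 2)` if `L < (D + 1) / 2` (`volume_layerCorrSet`), and this set does not
depend on `Q₀`.

It remains to see that the correlations of a randomly rotated `Σ` avoid any fixed null set
(`haarOrthogonal_corr_mem`). In Cayley charts the correlation map goes between spaces of equal
dimension. It is a local diffeomorphism wherever the eigenbasis `U` has invertible `U ⊙ U`, because
conjugation is then transversal to rescaling (`eq_zero_of_commutator_eq_rescaling`). The exceptional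
set is the zero set of a nonzero polynomial, hence null. Fubini over the first rotation concludes.
-/

/-! ### Gaussian mass of half-spaces and cubes -/

/-- The measure of a half-space at distance `s` from the origin is at most `exp (-s² / 2)`. -/
theorem stdGaussian_real_halfspace_le {E : Type*} [NormedAddCommGroup E] [InnerProductSpace ℝ E]
    [FiniteDimensional ℝ E] [MeasurableSpace E] [BorelSpace E] {e : E} (he : ‖e‖ = 1)
    {s : ℝ} (hs : 0 ≤ s) :
    (stdGaussian E).real {y | s ≤ inner ℝ e y} ≤ Real.exp (-(s ^ 2 / 2)) := by
  have hmap : (stdGaussian E).map (innerSL ℝ e) = gaussianReal 0 1 := by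
    rw [IsGaussian.map_eq_gaussianReal, integral_strongDual_stdGaussian,
      variance_dual_stdGaussian, innerSL_apply_norm, he]
    simp
  have h1 : (stdGaussian E).real {y | s ≤ inner ℝ e y} =
      (gaussianReal 0 1).real {x | s ≤ id x} := by
    rw [← hmap, map_measureReal_apply (by fun_prop) (measurableSet_le measurable_const measurable_id)]
    rfl
  rw [h1]
  -- Chernoff bound with the optimal parameter, which is `s` itself.
  refine (measure_ge_le_exp_mul_mgf s hs (by simpa using integrable_exp_mul_gaussianReal s)).trans ?_
  rw [mgf_id_gaussianReal, ← Real.exp_add]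
  apply le_of_eq
  congr 1
  simp
  ring

theorem gaussianReal_real_Icc_ge (a : ℝ) :
    (√(2 * Real.pi))⁻¹ * Real.exp (-((|a| + 1) ^ 2 / 2)) ≤
      (gaussianReal 0 1).real (Set.Icc a (a + 1)) := by
  rw [measureReal_def, gaussianReal_apply_eq_integral _ one_ne_zero, ENNReal.toReal_ofReal
    (integral_nonneg fun _ => gaussianPDFReal_nonneg _ _ _)]
  have h := setIntegral_mono_on (μ := volume) (s := Set.Icc a (a + 1))
    (f := fun _ => (√(2 * Real.pi))⁻¹ * Real.exp (-((|a| + 1) ^ 2 / 2)))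
    (g := gaussianPDFReal 0 1) (integrableOn_const (by simp))
    (integrable_gaussianPDFReal 0 1).integrableOn measurableSet_Icc (fun x hx => by
      rw [gaussianPDFReal_def]
      simp only [NNReal.coe_one, mul_one, sub_zero]
      gcongr
      rw [neg_div]
      apply neg_le_neg
      gcongr ?_ / 2
      apply sq_le_sq'
      · linarith [neg_abs_le a, hx.1]
      · linarith [le_abs_self a, hx.2])
  simpa using h

theorem stdGaussian_real_cube_ge {ι : Type*} [Fintype ι] (a : ι → ℝ) :
    ∏ i, ((√(2 * Real.pi))⁻¹ * Real.exp (-((|a i| + 1) ^ 2 / 2))) ≤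
      (stdGaussian (EuclideanSpace ℝ ι)).real {y | ∀ i, y i ∈ Set.Icc (a i) (a i + 1)} := by
  rw [← map_pi_eq_stdGaussian, map_measureReal_apply (by fun_prop)]
  · have : (WithLp.toLp 2 : (ι → ℝ) → EuclideanSpace ℝ ι) ⁻¹'
        {y | ∀ i, y i ∈ Set.Icc (a i) (a i + 1)} =
        Set.pi Set.univ fun i => Set.Icc (a i) (a i + 1) := by
      ext y; simp [Pi.le_def, forall_and]
    rw [this, measureReal_def, Measure.pi_pi, ENNReal.toReal_prod]
    exact Finset.prod_le_prod (fun i _ => by positivity) fun i _ => gaussianReal_real_Icc_ge _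
  · simp only [Set.ofPred_forall]
    exact MeasurableSet.iInter fun i => measurableSet_Icc.preimage (by fun_prop)

instance isOpenPosMeasure_stdGaussian {ι : Type*} [Fintype ι] :
    (stdGaussian (EuclideanSpace ℝ ι)).IsOpenPosMeasure := by
  have : (gaussianReal 0 1).IsOpenPosMeasure :=
    (gaussianReal_absolutelyContinuous' 0 one_ne_zero).isOpenPosMeasure
  rw [← map_pi_eq_stdGaussian]
  exact Continuous.isOpenPosMeasure_map (by fun_prop) (WithLp.toLp_surjective 2)

/-! ### Blow-downs at infinity -/

/-- `A` is the blow-down of `Φ` at infinity: `Φ (t y) / t → A x` as `t → ∞` and `y → x`. -/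
def HasBlowdown {E F : Type*} [NormedAddCommGroup E] [NormedSpace ℝ E] [NormedAddCommGroup F]
    [NormedSpace ℝ F] (Φ : E → F) (A : E → F) : Prop :=
  ∀ x, Tendsto (fun p : ℝ × E => p.1⁻¹ • Φ (p.1 • p.2)) (atTop ×ˢ 𝓝 x) (𝓝 (A x))

namespace HasBlowdown

variable {E F G : Type*} [NormedAddCommGroup E] [NormedSpace ℝ E] [NormedAddCommGroup F]
    [NormedSpace ℝ F] [NormedAddCommGroup G] [NormedSpace ℝ G]

theorem comp {Ψ : F → G} {B : F → G} {Φ : E → F} {A : E → F} (hΨ : HasBlowdown Ψ B)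
    (hΦ : HasBlowdown Φ A) : HasBlowdown (Ψ ∘ Φ) (B ∘ A) := by
  intro x
  have h1 : Tendsto (fun p : ℝ × E => (p.1, p.1⁻¹ • Φ (p.1 • p.2))) (atTop ×ˢ 𝓝 x)
      (atTop ×ˢ 𝓝 (A x)) := tendsto_fst.prodMk (hΦ x)
  refine ((hΨ (A x)).comp h1).congr' ?_
  have : ∀ᶠ p : ℝ × E in atTop ×ˢ 𝓝 x, 0 < p.1 := tendsto_fst.eventually (eventually_gt_atTop 0)
  filter_upwards [this] with p hp
  simp [smul_smul, hp.ne']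

theorem of_clm (R : E →L[ℝ] F) : HasBlowdown R R := by
  intro x
  refine (((R.continuous.tendsto x).comp tendsto_snd).congr' ?_)
  have : ∀ᶠ p : ℝ × E in atTop ×ˢ 𝓝 x, 0 < p.1 := tendsto_fst.eventually (eventually_gt_atTop 0)
  filter_upwards [this] with p hp
  simp [smul_smul, hp.ne']

theorem unique {Φ A B : E → E} (h : HasBlowdown Φ A) (h' : HasBlowdown Φ B) : A = B :=
  funext fun x => tendsto_nhds_unique (h x) (h' x)

theorem id : HasBlowdown (id : E → E) id := of_clm (ContinuousLinearMap.id ℝ E)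

end HasBlowdown

/-- The blow-down of a map preserving the standard Gaussian measure does not increase norms. -/
theorem HasBlowdown.norm_le_of_map_stdGaussian {ι : Type*} [Fintype ι]
    {Φ A : EuclideanSpace ℝ ι → EuclideanSpace ℝ ι} (h : HasBlowdown Φ A) (hm : Measurable Φ)
    (hmap : (stdGaussian (EuclideanSpace ℝ ι)).map Φ = stdGaussian (EuclideanSpace ℝ ι))
    (x : EuclideanSpace ℝ ι) : ‖A x‖ ≤ ‖x‖ := by
  by_contra! hlt
  set z := A x
  have hz0 : 0 < ‖z‖ := (norm_nonneg x).trans_lt hlt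
  -- For large `t` the unit cube at `t x` is mapped into a half-space at distance `t β`. Its mass
  -- `exp (-t² ‖x‖² / 2 - O(t))` would then be at most `exp (-t² β² / 2)`, which fails for large `t`
  -- because `β > ‖x‖`.
  obtain ⟨β, hβ1, hβ2⟩ := exists_between hlt
  have hβ0 : 0 ≤ β := (norm_nonneg x).trans hβ1.le
  set e := ‖z‖⁻¹ • z with he
  have hen : ‖e‖ = 1 := by rw [he, norm_smul, norm_inv, norm_norm, inv_mul_cancel₀ hz0.ne']
  have hez : inner ℝ e z = ‖z‖ := by
    rw [he, real_inner_smul_left, real_inner_self_eq_norm_sq]; field_simp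
  -- the image of a cube far out lies in a half-space
  have h1 : ∀ᶠ p : ℝ × EuclideanSpace ℝ ι in atTop ×ˢ 𝓝 x,
      β < inner ℝ e (p.1⁻¹ • Φ (p.1 • p.2)) := by
    have : Tendsto (fun p : ℝ × EuclideanSpace ℝ ι => inner ℝ e (p.1⁻¹ • Φ (p.1 • p.2)))
        (atTop ×ˢ 𝓝 x) (𝓝 (inner ℝ e z)) := (innerSL ℝ e).continuous.tendsto z |>.comp (h x)
    exact this.eventually (lt_mem_nhds (by rw [hez]; exact hβ2))
  obtain ⟨P, hP, U, hU, hPU⟩ := eventually_prod_iff.mp h1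
  obtain ⟨δ, hδ, hball⟩ := Metric.eventually_nhds_iff.mp hU
  -- The diameter of the unit cube: after division by `t > s / δ` the cube lies within `δ` of `x`.
  set s := Real.sqrt (Fintype.card ι)
  have h2 : ∀ᶠ t : ℝ in atTop, (∏ i, ((√(2 * Real.pi))⁻¹ *
      Real.exp (-((|t * x i| + 1) ^ 2 / 2)))) ≤ Real.exp (-((t * β) ^ 2 / 2)) := by
    filter_upwards [hP, eventually_gt_atTop 0, eventually_gt_atTop (s / δ)] with t ht ht0 hts
    refine (stdGaussian_real_cube_ge fun i => t * x i).trans ?_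
    refine le_trans ?_ (stdGaussian_real_halfspace_le (E := EuclideanSpace ℝ ι) hen
      (s := t * β) (by positivity))
    conv_rhs => rw [← hmap]
    rw [map_measureReal_apply hm (by measurability)]
    apply measureReal_mono _ (by finiteness)
    intro y hy
    have hy' : dist (t⁻¹ • y) x < δ := by
      have hyx : ‖y - t • x‖ ≤ s := by
        rw [EuclideanSpace.norm_eq]
        apply Real.sqrt_le_sqrt
        calc ∑ i, ‖(y - t • x) i‖ ^ 2 ≤ ∑ i : ι, (1 : ℝ) := by
              apply Finset.sum_le_sum
              intro i _
              have := hy i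
              simp only [Set.mem_Icc] at this
              have h0 : (y - t • x) i = y i - t * x i := by simp
              rw [h0, Real.norm_eq_abs, sq_abs]
              nlinarith [this.1, this.2]
          _ = _ := by simp
      have : t⁻¹ • y - x = t⁻¹ • (y - t • x) := by
        rw [smul_sub, smul_smul, inv_mul_cancel₀ ht0.ne', one_smul]
      rw [dist_eq_norm, this, norm_smul, norm_inv, Real.norm_of_nonneg ht0.le]
      calc t⁻¹ * ‖y - t • x‖ ≤ t⁻¹ * s := by gcongr
        _ < δ := by rw [inv_mul_lt_iff₀ ht0]; rwa [div_lt_iff₀ hδ] at hts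
    have := hPU ht (hball hy')
    simp only [smul_smul, mul_inv_cancel₀ ht0.ne', one_smul, real_inner_smul_right] at this
    rw [lt_inv_mul_iff₀ ht0] at this
    exact this.le
  -- compare the growth rates of the logarithms
  have h3 : ∀ t : ℝ, 0 < t → (∏ i, ((√(2 * Real.pi))⁻¹ *
      Real.exp (-((|t * x i| + 1) ^ 2 / 2)))) = Real.exp (-(t ^ 2 * ‖x‖ ^ 2 / 2 +
        t * (∑ i, |x i|) + Fintype.card ι * (1 / 2 + Real.log (√(2 * Real.pi))))) := by
    intro t ht
    have hpi : (√(2 * Real.pi))⁻¹ = Real.exp (-Real.log (√(2 * Real.pi))) := by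
      rw [Real.exp_neg, Real.exp_log (by positivity)]
    rw [hpi]
    simp_rw [← Real.exp_add]
    rw [← Real.exp_sum, EuclideanSpace.real_norm_sq_eq]
    congr 1
    have : ∀ i, -Real.log (√(2 * Real.pi)) + -((|t * x i| + 1) ^ 2 / 2) =
      -(t ^ 2 * (x i) ^ 2 / 2) - t * |x i| - (1 / 2 + Real.log (√(2 * Real.pi))) := by
      intro i
      rw [abs_mul, abs_of_pos ht, ← sq_abs (x i)]
      ring
    simp_rw [this]
    simp only [Finset.sum_sub_distrib, Finset.sum_neg_distrib, ← Finset.sum_div, ← Finset.mul_sum,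
      Finset.sum_const, Finset.card_univ, nsmul_eq_mul]
    ring
  set b := ∑ i, |x i|
  set c := Fintype.card ι * (1 / 2 + Real.log (√(2 * Real.pi)))
  have hq : 0 < (β ^ 2 - ‖x‖ ^ 2) / 2 := by
    have := pow_lt_pow_left₀ hβ1 (norm_nonneg x) two_ne_zero
    linarith
  have h4 : Tendsto (fun t : ℝ => t * (t * ((β ^ 2 - ‖x‖ ^ 2) / 2) - b)) atTop atTop :=
    tendsto_id.atTop_mul_atTop₀
      (tendsto_atTop_add_const_right _ (-b) (tendsto_id.atTop_mul_const hq))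
  obtain ⟨t, ht, ht0, htc⟩ :=
    (h2.and ((eventually_gt_atTop 0).and (h4.eventually_gt_atTop c))).exists
  rw [h3 t ht0, Real.exp_le_exp] at ht
  nlinarith

/-! ### Homeomorphisms of the line with linear tails -/

theorem tendsto_div_of_rightInverse {f g : ℝ → ℝ} (hfg : Function.RightInverse g f)
    {l l' : Filter ℝ} (hg : Tendsto g l l') {a : ℝ} (ha : a ≠ 0)
    (hf : Tendsto (fun t => f t / t) l' (𝓝 a)) :
    Tendsto (fun s => g s / s) l (𝓝 a⁻¹) :=
  ((hf.comp hg).inv₀ ha).congr fun s => by simp [hfg s]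

/-- The inverse of a homeomorphism of the line with linear tails has linear tails. -/
theorem HasLinearTails.symm {f : ℝ ≃ₜ ℝ} (hf : HasLinearTails f) : HasLinearTails f.symm := by
  obtain ⟨⟨a, ha, hfa⟩, b, hb, hfb⟩ := hf
  have hinv : Function.RightInverse f.symm f := f.apply_symm_apply
  rcases f.symm.continuous.strictMono_of_inj f.symm.injective with h | h
  · have h1 : Tendsto f.symm atTop atTop := h.monotone.tendsto_atTop_atTop fun y =>
      ⟨f y, (f.symm_apply_apply y).ge⟩
    have h2 : Tendsto f.symm atBot atBot := h.monotone.tendsto_atBot_atBot fun y =>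
      ⟨f y, (f.symm_apply_apply y).le⟩
    exact ⟨⟨a⁻¹, inv_ne_zero ha, tendsto_div_of_rightInverse hinv h1 ha hfa⟩,
      b⁻¹, inv_ne_zero hb, tendsto_div_of_rightInverse hinv h2 hb hfb⟩
  -- For a decreasing homeomorphism the two ends are exchanged, and so are the two slopes.
  · have hmono : Monotone fun y => -f.symm y := fun x y hxy => neg_le_neg (h.antitone hxy)
    have h1 : Tendsto f.symm atTop atBot := tendsto_neg_atTop_iff.mp
      (hmono.tendsto_atTop_atTop fun y => ⟨f (-y), by simp⟩)
    have h2 : Tendsto f.symm atBot atTop := tendsto_neg_atBot_iff.mp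
      (hmono.tendsto_atBot_atBot fun y => ⟨f (-y), by simp⟩)
    exact ⟨⟨b⁻¹, inv_ne_zero hb, tendsto_div_of_rightInverse hinv h1 hb hfb⟩,
      a⁻¹, inv_ne_zero ha, tendsto_div_of_rightInverse hinv h2 ha hfa⟩

theorem exists_affine_bound_of_tails {f : ℝ → ℝ} (hc : Continuous f) {a b : ℝ}
    (ha : Tendsto (fun t => f t / t) atTop (𝓝 a)) (hb : Tendsto (fun t => f t / t) atBot (𝓝 b)) :
    ∃ K C : ℝ, ∀ s, |f s| ≤ K * |s| + C := by
  obtain ⟨M, hM⟩ := eventually_atTop.mp (ha.abs.eventually (gt_mem_nhds (lt_add_one |a|)))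
  obtain ⟨N, hN⟩ := eventually_atBot.mp (hb.abs.eventually (gt_mem_nhds (lt_add_one |b|)))
  obtain ⟨C, hC⟩ := (isCompact_Icc (a := min N (-1)) (b := max M 1)).exists_bound_of_continuousOn
    hc.continuousOn
  have hC0 : 0 ≤ C := (norm_nonneg _).trans
    (hC 0 ⟨(min_le_right _ _).trans (by norm_num), le_trans (by norm_num) (le_max_right _ _)⟩)
  refine ⟨(|a| + 1) + (|b| + 1), C, fun s => ?_⟩
  have hs := abs_nonneg s
  have haa := abs_nonneg a
  have hbb := abs_nonneg b
  rcases lt_or_ge s (min N (-1)) with h | h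
  · have := (hN s (h.le.trans (min_le_left _ _))).le
    have hs0 : 0 < |s| := abs_pos.mpr fun h0 => by
      rw [h0] at h; linarith [min_le_right N (-1)]
    rw [abs_div, div_le_iff₀ hs0] at this
    nlinarith
  rcases lt_or_ge (max M 1) s with h' | h'
  · have := (hM s ((le_max_left _ _).trans h'.le)).le
    have hs0 : 0 < |s| := abs_pos.mpr fun h0 => by
      rw [h0] at h'; linarith [le_max_right M 1]
    rw [abs_div, div_le_iff₀ hs0] at this
    nlinarith
  · have := hC s ⟨h, h'⟩
    rw [Real.norm_eq_abs] at this
    nlinarith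

/-- Away from `y = 0` the argument `t y` runs into one tail. At `y = 0` it may stay bounded or
oscillate between the tails, so the limit comes from the affine bound on `f`. -/
theorem hasBlowdown_of_tails {f : ℝ → ℝ} (hc : Continuous f) {a b : ℝ}
    (ha : Tendsto (fun t => f t / t) atTop (𝓝 a)) (hb : Tendsto (fun t => f t / t) atBot (𝓝 b)) :
    HasBlowdown f fun y => (if 0 ≤ y then a else b) * y := by
  intro y
  have hpos : ∀ᶠ p : ℝ × ℝ in atTop ×ˢ 𝓝 y, 0 < p.1 :=
    tendsto_fst.eventually (eventually_gt_atTop 0)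
  rcases lt_trichotomy y 0 with hy | rfl | hy
  · have h1 : Tendsto (fun p : ℝ × ℝ => p.1 * p.2) (atTop ×ˢ 𝓝 y) atBot :=
      tendsto_fst.atTop_mul_neg hy tendsto_snd
    have h2 := (hb.comp h1).mul (tendsto_snd (f := (atTop : Filter ℝ)) (g := 𝓝 y))
    beta_reduce
    rw [if_neg hy.not_ge]
    refine h2.congr' ?_
    filter_upwards [hpos, tendsto_snd.eventually (gt_mem_nhds hy)] with p hp hp2
    have := hp2.ne
    simp only [Function.comp, smul_eq_mul]
    field_simp
  · simp only [mul_zero]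
    obtain ⟨K, C, hKC⟩ := exists_affine_bound_of_tails hc ha hb
    have h1 : Tendsto (fun p : ℝ × ℝ => K * |p.2| + p.1⁻¹ * C) (atTop ×ˢ 𝓝 0) (𝓝 0) := by
      have h2 : Tendsto (fun p : ℝ × ℝ => |p.2|) (atTop ×ˢ 𝓝 0) (𝓝 0) := by
        simpa using (tendsto_snd (f := (atTop : Filter ℝ)) (g := 𝓝 (0 : ℝ))).abs
      have h3 : Tendsto (fun p : ℝ × ℝ => p.1⁻¹) (atTop ×ˢ 𝓝 0) (𝓝 0) :=
        tendsto_inv_atTop_zero.comp tendsto_fst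
      simpa using (h2.const_mul K).add (h3.mul_const C)
    refine squeeze_zero_norm' ?_ h1
    filter_upwards [hpos] with p hp
    rw [norm_smul, norm_inv, Real.norm_of_nonneg hp.le, Real.norm_eq_abs]
    calc p.1⁻¹ * |f (p.1 • p.2)| ≤ p.1⁻¹ * (K * |p.1 • p.2| + C) := by
          gcongr; exact hKC _
      _ = K * |p.2| + p.1⁻¹ * C := by
          rw [smul_eq_mul, abs_mul, abs_of_pos hp]; field_simp
  · have h1 : Tendsto (fun p : ℝ × ℝ => p.1 * p.2) (atTop ×ˢ 𝓝 y) atTop :=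
      tendsto_fst.atTop_mul_pos hy tendsto_snd
    have h2 := (ha.comp h1).mul (tendsto_snd (f := (atTop : Filter ℝ)) (g := 𝓝 y))
    beta_reduce
    rw [if_pos hy.le]
    refine h2.congr' ?_
    filter_upwards [hpos, tendsto_snd.eventually (lt_mem_nhds hy)] with p hp hp2
    have := hp2.ne'
    simp only [Function.comp, smul_eq_mul]
    field_simp

theorem HasBlowdown.piLp {ι : Type*} [Fintype ι] {f A : ι → ℝ → ℝ}
    (h : ∀ i, HasBlowdown (f i) (A i)) :
    HasBlowdown (fun x : EuclideanSpace ℝ ι => WithLp.toLp 2 fun i => f i (x i))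
      (fun x : EuclideanSpace ℝ ι => WithLp.toLp 2 fun i => A i (x i)) := by
  intro x
  have h1 : Tendsto (fun p : ℝ × EuclideanSpace ℝ ι => fun i => p.1⁻¹ • f i (p.1 • p.2 i))
      (atTop ×ˢ 𝓝 x) (𝓝 fun i => A i (x i)) := by
    refine tendsto_pi_nhds.mpr fun i => ?_
    have hi : Tendsto (fun y : EuclideanSpace ℝ ι => y i) (𝓝 x) (𝓝 (x i)) :=
      Continuous.tendsto (by fun_prop) x
    exact (h i (x i)).comp (tendsto_fst.prodMk (hi.comp tendsto_snd))
  exact ((PiLp.continuous_toLp 2 _).tendsto _).comp h1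

/-! ### Blow-downs of Gaussianization maps -/

variable {D : ℕ}

/-- The matrix `diag(d (L-1)) Q (L-1) ⋯ diag(d 0) Q 0`. -/
noncomputable def layerProd : (L : ℕ) → (Fin L → Matrix.orthogonalGroup (Fin D) ℝ) →
    (Fin L → Fin D → ℝ) → Matrix (Fin D) (Fin D) ℝ
  | 0, _, _ => 1
  | L + 1, Q, d => diagonal (d (Fin.last L)) * (Q (Fin.last L) : Matrix (Fin D) (Fin D) ℝ) *
      layerProd L (fun l => Q l.castSucc) (fun l => d l.castSucc)

theorem gaussianizationBlock_eq (Q : Matrix.orthogonalGroup (Fin D) ℝ) (f : Fin D → ℝ ≃ₜ ℝ) :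
    gaussianizationBlock Q f = (fun x : EuclideanSpace ℝ (Fin D) =>
      WithLp.toLp 2 fun i => f i (x i)) ∘
      toEuclideanCLM (𝕜 := ℝ) (Q : Matrix (Fin D) (Fin D) ℝ) := rfl

/-- The inverse of a Gaussianization block. -/
noncomputable def gaussianizationBlockInv (Q : Matrix.orthogonalGroup (Fin D) ℝ)
    (f : Fin D → ℝ ≃ₜ ℝ) : EuclideanSpace ℝ (Fin D) → EuclideanSpace ℝ (Fin D) :=
  toEuclideanCLM (𝕜 := ℝ) ((Q : Matrix (Fin D) (Fin D) ℝ)ᵀ) ∘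
    fun x => WithLp.toLp 2 fun i => (f i).symm (x i)

theorem orthogonalGroup_transpose_mul (Q : Matrix.orthogonalGroup (Fin D) ℝ) :
    (Q : Matrix (Fin D) (Fin D) ℝ)ᵀ * (Q : Matrix (Fin D) (Fin D) ℝ) = 1 :=
  (mem_orthogonalGroup_iff' _ _).mp Q.2

theorem gaussianizationBlockInv_comp (Q : Matrix.orthogonalGroup (Fin D) ℝ)
    (f : Fin D → ℝ ≃ₜ ℝ) : gaussianizationBlockInv Q f ∘ gaussianizationBlock Q f = id := by
  funext x
  simp [gaussianizationBlockInv, gaussianizationBlock, toEuclideanCLM_toLp, mulVec_mulVec,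
    orthogonalGroup_transpose_mul]

theorem continuous_gaussianizationBlock (Q : Matrix.orthogonalGroup (Fin D) ℝ)
    (f : Fin D → ℝ ≃ₜ ℝ) : Continuous (gaussianizationBlock Q f) := by
  rw [gaussianizationBlock_eq]
  have := fun i => (f i).continuous
  fun_prop

theorem continuous_gaussianizationBlockInv (Q : Matrix.orthogonalGroup (Fin D) ℝ)
    (f : Fin D → ℝ ≃ₜ ℝ) : Continuous (gaussianizationBlockInv Q f) := by
  unfold gaussianizationBlockInv
  have := fun i => (f i).symm.continuous
  fun_prop

theorem gaussianization_succ (L : ℕ) (Q : Fin (L + 1) → Matrix.orthogonalGroup (Fin D) ℝ)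
    (f : Fin (L + 1) → Fin D → ℝ ≃ₜ ℝ) :
    gaussianization (L + 1) Q f = gaussianizationBlock (Q (Fin.last L)) (f (Fin.last L)) ∘
      gaussianization L (fun l => Q l.castSucc) (fun l => f l.castSucc) := rfl

theorem continuous_gaussianization : ∀ (L : ℕ) (Q : Fin L → Matrix.orthogonalGroup (Fin D) ℝ)
    (f : Fin L → Fin D → ℝ ≃ₜ ℝ), Continuous (gaussianization L Q f)
  | 0, _, _ => continuous_id
  | L + 1, _, _ => (continuous_gaussianizationBlock _ _).comp (continuous_gaussianization L _ _)

/-- The inverse of a Gaussianization map is continuous and has a blow-down. -/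
theorem exists_inverse_gaussianization : ∀ (L : ℕ)
    (Q : Fin L → Matrix.orthogonalGroup (Fin D) ℝ) (f : Fin L → Fin D → ℝ ≃ₜ ℝ)
    (_ : ∀ l i, HasLinearTails (f l i)),
    ∃ Ψ B : EuclideanSpace ℝ (Fin D) → EuclideanSpace ℝ (Fin D), Continuous Ψ ∧
      Ψ ∘ gaussianization L Q f = id ∧ HasBlowdown Ψ B
  | 0, _, _, _ => ⟨id, id, continuous_id, rfl, HasBlowdown.id⟩
  | L + 1, Q, f, hf => by
    obtain ⟨Ψ, B, hc, h1, hB⟩ := exists_inverse_gaussianization L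
      (fun l => Q l.castSucc) (fun l => f l.castSucc) (fun l i => hf _ i)
    have hs : ∀ i, ∃ A, HasBlowdown ((f (Fin.last L) i).symm) A := fun i => by
      obtain ⟨⟨a, -, ha⟩, b, -, hb⟩ := (hf (Fin.last L) i).symm
      exact ⟨_, hasBlowdown_of_tails (f (Fin.last L) i).symm.continuous ha hb⟩
    choose A hA using hs
    refine ⟨Ψ ∘ gaussianizationBlockInv (Q (Fin.last L)) (f (Fin.last L)), _,
      hc.comp (continuous_gaussianizationBlockInv _ _), ?_,
      hB.comp ((HasBlowdown.of_clm _).comp (HasBlowdown.piLp hA))⟩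
    rw [gaussianization_succ, Function.comp_assoc, ← Function.comp_assoc _ _ (gaussianization L _ _),
      gaussianizationBlockInv_comp, Function.id_comp, h1]

/-- The blow-down of a Gaussianization map is piecewise linear; each piece is a product of the
rotations and of diagonal matrices of tail slopes. -/
theorem exists_blowdown_gaussianization (L : ℕ)
    (Q : Fin L → Matrix.orthogonalGroup (Fin D) ℝ) (f : Fin L → Fin D → ℝ ≃ₜ ℝ)
    (c : Bool → Fin L → Fin D → ℝ)
    (ht : ∀ l i, Tendsto (fun t => f l i t / t) atTop (𝓝 (c true l i)))
    (hb : ∀ l i, Tendsto (fun t => f l i t / t) atBot (𝓝 (c false l i))) :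
    ∃ A : EuclideanSpace ℝ (Fin D) → EuclideanSpace ℝ (Fin D),
      HasBlowdown (gaussianization L Q f) A ∧ ∀ x, ∃ σ : Fin L → Fin D → Bool,
        A x = toEuclideanCLM (𝕜 := ℝ) (layerProd L Q fun l i => c (σ l i) l i) x := by
  induction L with
  | zero => exact ⟨id, HasBlowdown.id, fun x => ⟨fun l => l.elim0, by simp [layerProd]⟩⟩
  | succ L ih =>
    obtain ⟨A, hA, hσ⟩ := ih
      (fun l => Q l.castSucc) (fun l => f l.castSucc) (fun s l => c s l.castSucc)
      (fun l i => ht _ i) (fun l i => hb _ i)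
    have h1 := HasBlowdown.piLp fun i => hasBlowdown_of_tails (f (Fin.last L) i).continuous
      (ht (Fin.last L) i) (hb (Fin.last L) i)
    have h2 := h1.comp (HasBlowdown.of_clm
      (toEuclideanCLM (𝕜 := ℝ) (Q (Fin.last L) : Matrix (Fin D) (Fin D) ℝ)))
    rw [← gaussianizationBlock_eq] at h2
    refine ⟨_, h2.comp hA, fun x => ?_⟩
    obtain ⟨σ, hx⟩ := hσ x
    set y := toEuclideanCLM (𝕜 := ℝ) (Q (Fin.last L) : Matrix (Fin D) (Fin D) ℝ) (A x) with hy
    -- The signs of the coordinates entering the new layer select its tail slopes.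
    refine ⟨Fin.snoc σ fun i => decide (0 ≤ y i), ?_⟩
    have hl : layerProd (L + 1) Q (fun l i => c ((Fin.snoc σ fun i => decide (0 ≤ y i) :
        Fin (L + 1) → Fin D → Bool) l i) l i) =
        diagonal (fun i => c (decide (0 ≤ y i)) (Fin.last L) i) * Q (Fin.last L) *
          layerProd L (fun l => Q l.castSucc) fun l i => c (σ l i) l.castSucc i := by
      simp only [layerProd, Fin.snoc_castSucc, Fin.snoc_last]
    rw [hl, map_mul, map_mul, mul_apply_eq_comp, mul_apply_eq_comp, ← hx,
      ← hy]
    ext i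
    rw [ofLp_toEuclideanCLM, mulVec_diagonal]
    change (if 0 ≤ y i then _ else _) * y i = _
    by_cases h : 0 ≤ y i <;> simp [h]

/-! ### Reduction to linear Gaussianization -/

/-- Apply the parallelogram law to `x ± s • v` with `x` interior and `s` small: three of the four
norms are preserved, so the fourth, that of `s • v`, is too. -/
theorem norm_map_eq_of_interior_nonempty {E : Type*} [NormedAddCommGroup E] [InnerProductSpace ℝ E]
    {T : E →L[ℝ] E} (h : (interior {x | ‖T x‖ = ‖x‖}).Nonempty) (v : E) : ‖T v‖ = ‖v‖ := by
  obtain ⟨x, hx⟩ := h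
  have hx0 : ∀ᶠ y in 𝓝 x, ‖T y‖ = ‖y‖ := mem_interior_iff_mem_nhds.mp hx
  have h1 : ∀ᶠ s : ℝ in 𝓝 0, ‖T (x + s • v)‖ = ‖x + s • v‖ :=
    (show Tendsto (fun s : ℝ => x + s • v) (𝓝 0) (𝓝 x) from
      Continuous.tendsto' (by fun_prop) _ _ (by simp)).eventually hx0
  have h2 : ∀ᶠ s : ℝ in 𝓝 0, ‖T (x - s • v)‖ = ‖x - s • v‖ :=
    (show Tendsto (fun s : ℝ => x - s • v) (𝓝 0) (𝓝 x) from
      Continuous.tendsto' (by fun_prop) _ _ (by simp)).eventually hx0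
  obtain ⟨s, ⟨hs1, hs2⟩, hs⟩ :=
    (((h1.and h2).filter_mono nhdsWithin_le_nhds).and (self_mem_nhdsWithin (s := Set.Ioi 0))).exists
  have p1 := parallelogram_law_with_norm ℝ (T x) (T (s • v))
  have p2 := parallelogram_law_with_norm ℝ x (s • v)
  rw [← map_add, ← map_sub, hs1, hs2, hx0.self_of_nhds, map_smul, norm_smul] at p1
  rw [norm_smul] at p2
  have hs' : 0 < ‖s‖ := norm_pos_iff.mpr (ne_of_gt hs)
  have : ‖s‖ * ‖T v‖ * (‖s‖ * ‖T v‖) = ‖s‖ * ‖v‖ * (‖s‖ * ‖v‖) := by linarith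
  have := (mul_self_inj (by positivity) (by positivity)).mp this
  exact mul_left_cancel₀ hs'.ne' this

open scoped MatrixOrder in
/-- If Gaussianization with rotations `Q` represents `N(0, S)` exactly, then so does a linear
Gaussianization with the same rotations. -/
theorem ExactlyRepresentable.exists_layerProd_mul_mul_transpose {D L : ℕ}
    {S : Matrix (Fin D) (Fin D) ℝ} (hS : S.PosSemidef)
    {Q : Fin L → Matrix.orthogonalGroup (Fin D) ℝ}
    (h : ExactlyRepresentable (multivariateGaussian 0 S) Q) :
    ∃ d : Fin L → Fin D → ℝ, (∀ l i, d l i ≠ 0) ∧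
      layerProd L Q d * S * (layerProd L Q d)ᵀ = 1 := by
  obtain ⟨f, hf, hmap⟩ := h
  have hRR : CFC.sqrt S * CFC.sqrt S = S := CFC.sqrt_mul_sqrt_self _ hS.nonneg
  have hRT : (CFC.sqrt S)ᵀ = CFC.sqrt S := by
    have := (CFC.sqrt_nonneg S).isSelfAdjoint.star_eq
    rwa [star_eq_conjTranspose, conjTranspose_eq_transpose_of_trivial] at this
  set r := CFC.sqrt S
  set R := toEuclideanCLM (𝕜 := ℝ) r with hR
  set γ := stdGaussian (EuclideanSpace ℝ (Fin D)) with hγ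
  set Φ := gaussianization L Q f with hΦ
  have hΦc : Continuous Φ := continuous_gaussianization L Q f
  have hmR : multivariateGaussian 0 S = γ.map R := by
    simp only [multivariateGaussian, zero_add]; rfl
  rw [hmR] at hmap
  choose a b ha hb hta htb using fun l i => (⟨_, _, (hf l i).1.choose_spec.1,
    (hf l i).2.choose_spec.1, (hf l i).1.choose_spec.2, (hf l i).2.choose_spec.2⟩ :
    ∃ a b : ℝ, a ≠ 0 ∧ b ≠ 0 ∧ Tendsto (fun t => f l i t / t) atTop (𝓝 a) ∧
      Tendsto (fun t => f l i t / t) atBot (𝓝 b))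
  obtain ⟨A, hA, hσ⟩ := exists_blowdown_gaussianization L Q f (fun s => if s then a else b)
    (by simpa using hta) (by simpa using htb)
  obtain ⟨Ψ, B, hΨc, hΨΦ, hB⟩ := exists_inverse_gaussianization L Q f hf
  have hBA : B ∘ A = id := (hB.comp hA).unique (hΨΦ ▸ HasBlowdown.id)
  have hmΨ : γ.map Ψ = γ.map R := by
    conv_lhs => rw [← hmap]
    rw [Measure.map_map hΨc.measurable hΦc.measurable, hΨΦ, Measure.map_id]
  -- `R` is surjective since `γ` has full support
  have hsurj : Function.Surjective R := by
    have hcl : IsClosed (Set.range R) := by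
      have := Submodule.closed_of_finiteDimensional (LinearMap.range R.toLinearMap)
      exact this
    have h0 : γ (Ψ ⁻¹' (Set.range R)ᶜ) = 0 := by
      rw [← Measure.map_apply hΨc.measurable hcl.measurableSet.compl, hmΨ,
        Measure.map_apply R.continuous.measurable hcl.measurableSet.compl]
      convert measure_empty (μ := γ)
      ext x; simp
    have h1 := (hcl.isOpen_compl.preimage hΨc).eq_empty_of_measure_zero h0
    intro y
    by_contra hy
    have : Φ y ∈ Ψ ⁻¹' (Set.range R)ᶜ := by
      have h2 : Ψ (Φ y) = y := congrFun hΨΦ y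
      rw [Set.mem_preimage, h2]; exact hy
    rw [h1] at this
    exact this
  have hunit : IsUnit r := by
    rw [← mulVec_surjective_iff_isUnit]
    intro y
    obtain ⟨x, hx⟩ := hsurj (WithLp.toLp 2 y)
    exact ⟨x.ofLp, by rw [← ofLp_toEuclideanCLM, ← hR, hx]⟩
  have hdet : IsUnit r.det := (isUnit_iff_isUnit_det r).mp hunit
  set R' := toEuclideanCLM (𝕜 := ℝ) r⁻¹ with hR'
  have hR'R : ∀ x, R' (R x) = x := fun x => by
    rw [hR, hR', ← mul_apply_eq_comp, ← map_mul, nonsing_inv_mul r hdet, map_one]; rfl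
  -- `Φ ∘ R` and its inverse `R' ∘ Ψ` both preserve `γ`, so neither blow-down increases norms. The
  -- blow-downs satisfy `B ∘ A = id`, which forces equality.
  have hn1 : ∀ x, ‖A (R x)‖ ≤ ‖x‖ :=
    (hA.comp (HasBlowdown.of_clm R)).norm_le_of_map_stdGaussian
      (hΦc.comp R.continuous).measurable
      (by rw [← Measure.map_map hΦc.measurable R.continuous.measurable]; exact hmap)
  have hn2 : ∀ z, ‖R' (B z)‖ ≤ ‖z‖ :=
    ((HasBlowdown.of_clm R').comp hB).norm_le_of_map_stdGaussian
      (R'.continuous.comp hΨc).measurable (by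
        rw [← Measure.map_map R'.continuous.measurable hΨc.measurable, ← hγ, hmΨ,
          Measure.map_map R'.continuous.measurable R.continuous.measurable,
          show R' ∘ R = id from funext hR'R, Measure.map_id])
  have hn : ∀ x, ‖A (R x)‖ = ‖x‖ := fun x => (hn1 x).antisymm (by
    have := hn2 (A (R x))
    rwa [show B (A (R x)) = R x from congrFun hBA _, hR'R] at this)
  let d : (Fin L → Fin D → Bool) → Fin L → Fin D → ℝ := fun σ l i =>
    (if σ l i then a else b) l i
  let T : (Fin L → Fin D → Bool) → EuclideanSpace ℝ (Fin D) →L[ℝ] EuclideanSpace ℝ (Fin D) :=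
    fun σ => toEuclideanCLM (𝕜 := ℝ) (layerProd L Q (d σ) * r)
  -- Baire: finitely many closed sets cover the space, since at each point `A ∘ R` agrees with some
  -- `T σ`.
  obtain ⟨σ, hint⟩ := nonempty_interior_of_iUnion_of_closed (f := fun σ => {x | ‖T σ x‖ = ‖x‖})
    (fun σ => isClosed_eq (T σ).continuous.norm continuous_norm) (by
      refine Set.eq_univ_of_forall fun x => ?_
      obtain ⟨σ, hx⟩ := hσ (R x)
      refine Set.mem_iUnion.mpr ⟨σ, ?_⟩
      change ‖T σ x‖ = ‖x‖
      rw [← hn x, hx]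
      simp only [T, map_mul, mul_apply_eq_comp]
      rfl)
  refine ⟨d σ, fun l i => ?_, ?_⟩
  · simp only [d]; split_ifs
    exacts [ha l i, hb l i]
  have hiso := ((T σ).norm_map_iff_adjoint_comp_self).mp (norm_map_eq_of_interior_nonempty hint)
  have hm : star (layerProd L Q (d σ) * r) * (layerProd L Q (d σ) * r) = 1 := by
    apply EquivLike.injective (toEuclideanCLM (n := Fin D) (𝕜 := ℝ))
    rw [map_mul, map_star, map_one]
    exact hiso
  -- For square matrices `XᵀX = 1` gives `X Xᵀ = 1`, and `r rᵀ = S`.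
  have hm' := mul_eq_one_comm.mp hm
  rw [star_eq_conjTranspose, conjTranspose_eq_transpose_of_trivial, transpose_mul, hRT] at hm'
  rw [← hRR, ← hm']
  simp only [mul_assoc]

/-! ### Correlations reachable by linear layers -/

/-- Positions above the diagonal of a `D × D` matrix. -/
abbrev UpperPairs (D : ℕ) : Type := {p : Fin D × Fin D // p.1 < p.2}

theorem card_upperPairs (D : ℕ) : Fintype.card (UpperPairs D) * 2 = D * (D - 1) := by
  have h : Fintype.card (UpperPairs D) = ∑ j : Fin D, (j : ℕ) := by
    rw [Fintype.card_subtype, Finset.card_filter, Fintype.sum_prod_type_right]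
    refine Finset.sum_congr rfl fun j _ => ?_
    rw [← Finset.card_filter]
    rw [← Fin.card_Iio j]
    congr 1
    ext i; simp
  rw [h, Fin.sum_univ_eq_sum_range (fun i => i), Finset.sum_range_id_mul_two]

/-- The off-diagonal entries of the correlation matrix of a covariance matrix. -/
noncomputable def corr (Y : Matrix (Fin D) (Fin D) ℝ) (p : UpperPairs D) : ℝ :=
  Y p.1.1 p.1.2 / (√(Y p.1.1 p.1.1) * √(Y p.1.2 p.1.2))

/-- Standard deviations scale by `|e i|`, so only signs survive. If `e i = 0`, both sides vanish by
`0 / 0 = 0` and `sign 0 = 0`. -/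
theorem corr_diagonal_mul_mul_diagonal (W : Matrix (Fin D) (Fin D) ℝ) (e : Fin D → ℝ)
    (p : UpperPairs D) : corr (diagonal e * W * diagonal e) p =
      SignType.sign (e p.1.1) * SignType.sign (e p.1.2) * corr W p := by
  have h : ∀ x : ℝ, x / |x| = SignType.sign x := fun x => by
    rcases eq_or_ne x 0 with rfl | hx
    · simp
    · rw [div_eq_iff (abs_ne_zero.mpr hx), sign_mul_abs]
  have h2 : ∀ i, √(e i * W i i * e i) = |e i| * √(W i i) := fun i => by
    rw [show e i * W i i * e i = e i ^ 2 * W i i by ring, Real.sqrt_mul (sq_nonneg _),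
      Real.sqrt_sq_eq_abs]
  simp only [corr, mul_diagonal, diagonal_mul, h2, ← h]
  rw [div_mul_div_comm, div_mul_div_comm]
  congr 1 <;> ring

/-- The matrix `(Q 0)ᵀ diag(e 0) (Q 1)ᵀ diag(e 1) ⋯`. -/
noncomputable def layerProdInv (L : ℕ) (Q : Fin L → Matrix.orthogonalGroup (Fin D) ℝ)
    (e : Fin L → Fin D → ℝ) : Matrix (Fin D) (Fin D) ℝ :=
  (List.ofFn fun l => (Q l : Matrix (Fin D) (Fin D) ℝ)ᵀ * diagonal (e l)).prod

/-- `layerProd` recurses on the last layer; the dimension count needs the first one split off. -/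
theorem layerProdInv_succ (L : ℕ) (Q : Fin (L + 1) → Matrix.orthogonalGroup (Fin D) ℝ)
    (e : Fin (L + 1) → Fin D → ℝ) : layerProdInv (L + 1) Q e =
      (Q 0 : Matrix (Fin D) (Fin D) ℝ)ᵀ * diagonal (e 0) *
        layerProdInv L (fun l => Q l.succ) (fun l => e l.succ) := by
  simp [layerProdInv, List.ofFn_succ]

theorem layerProdInv_mul_layerProd (L : ℕ) (Q : Fin L → Matrix.orthogonalGroup (Fin D) ℝ)
    (d : Fin L → Fin D → ℝ) (hd : ∀ l i, d l i ≠ 0) :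
    layerProdInv L Q (fun l i => (d l i)⁻¹) * layerProd L Q d = 1 := by
  induction L with
  | zero => simp [layerProdInv, layerProd]
  | succ L ih =>
    have h1 : layerProdInv (L + 1) Q (fun l i => (d l i)⁻¹) =
        layerProdInv L (fun l => Q l.castSucc) (fun l i => (d l.castSucc i)⁻¹) *
          ((Q (Fin.last L) : Matrix (Fin D) (Fin D) ℝ)ᵀ *
            diagonal fun i => (d (Fin.last L) i)⁻¹) := by
      rw [layerProdInv, List.ofFn_succ', List.concat_eq_append, List.prod_append, List.prod_singleton]
      rfl
    have h2 : (diagonal fun i => (d (Fin.last L) i)⁻¹) * diagonal (d (Fin.last L)) = 1 := by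
      rw [diagonal_mul_diagonal, ← diagonal_one]
      congr 1; funext i; exact inv_mul_cancel₀ (hd _ i)
    rw [h1, layerProd]
    calc _ = layerProdInv L (fun l => Q l.castSucc) (fun l i => (d l.castSucc i)⁻¹) *
          ((Q (Fin.last L) : Matrix (Fin D) (Fin D) ℝ)ᵀ *
            ((diagonal fun i => (d (Fin.last L) i)⁻¹) * diagonal (d (Fin.last L))) *
              (Q (Fin.last L) : Matrix (Fin D) (Fin D) ℝ)) *
            layerProd L (fun l => Q l.castSucc) (fun l => d l.castSucc) := by
          simp only [mul_assoc]
      _ = 1 := by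
          rw [h2, mul_one, orthogonalGroup_transpose_mul, mul_one]
          exact ih _ _ fun l i => hd _ i

theorem eq_layerProdInv_mul_transpose {L : ℕ} {Q : Fin L → Matrix.orthogonalGroup (Fin D) ℝ}
    {d : Fin L → Fin D → ℝ} (hd : ∀ l i, d l i ≠ 0) {S : Matrix (Fin D) (Fin D) ℝ}
    (h : layerProd L Q d * S * (layerProd L Q d)ᵀ = 1) :
    S = layerProdInv L Q (fun l i => (d l i)⁻¹) * (layerProdInv L Q fun l i => (d l i)⁻¹)ᵀ := by
  have h1 := layerProdInv_mul_layerProd L Q d hd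
  set N := layerProdInv L Q fun l i => (d l i)⁻¹
  set M := layerProd L Q d
  have h2 : Mᵀ * Nᵀ = 1 := by rw [← transpose_mul, h1, transpose_one]
  calc S = (N * M) * S * (Mᵀ * Nᵀ) := by rw [h1, h2, one_mul, mul_one]
    _ = N * (M * S * Mᵀ) * Nᵀ := by simp only [mul_assoc]
    _ = N * Nᵀ := by rw [h, mul_one]

/-- The correlation vectors, up to signs, of covariances that the layers with rotations `Q` can
produce from white noise. -/
def layerCorrSet (L : ℕ) (Q : Fin L → Matrix.orthogonalGroup (Fin D) ℝ) :
    Set (UpperPairs D → ℝ) :=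
  ⋃ s : UpperPairs D → SignType, (fun (e : Fin L → Fin D → ℝ) p =>
    (s p : ℝ) * corr (layerProdInv L Q e * (layerProdInv L Q e)ᵀ) p) ''
      {e | ∀ i, 0 < (layerProdInv L Q e * (layerProdInv L Q e)ᵀ) i i}

/-- Conjugation by `Q 0` leaves `diag(e 0) N Nᵀ diag(e 0)`, where `N` involves only the later
layers. The `D` scales `e 0` thus enter the correlations only through signs. -/
theorem corr_mem_layerCorrSet {L : ℕ} {Q : Fin (L + 1) → Matrix.orthogonalGroup (Fin D) ℝ}
    {e : Fin (L + 1) → Fin D → ℝ} {S : Matrix (Fin D) (Fin D) ℝ} (hS : S.PosDef)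
    (h : S = layerProdInv (L + 1) Q e * (layerProdInv (L + 1) Q e)ᵀ) :
    corr ((Q 0 : Matrix (Fin D) (Fin D) ℝ) * S * (Q 0 : Matrix (Fin D) (Fin D) ℝ)ᵀ) ∈
      layerCorrSet L fun l => Q l.succ := by
  set q := (Q 0 : Matrix (Fin D) (Fin D) ℝ) with hq
  have hqq : q * qᵀ = 1 := (mem_orthogonalGroup_iff _ _).mp (Q 0).2
  have hpos : (q * S * qᵀ).PosDef := by
    have hu : IsUnit q := IsUnit.of_mul_eq_one _ hqq
    rw [← conjTranspose_eq_transpose_of_trivial, ← star_eq_conjTranspose]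
    exact (IsUnit.posDef_star_right_conjugate_iff hu).mpr hS
  set N := layerProdInv L (fun l => Q l.succ) (fun l => e l.succ) with hN
  have hY : q * S * qᵀ = diagonal (e 0) * (N * Nᵀ) * diagonal (e 0) := by
    rw [h, layerProdInv_succ, ← hN, ← hq]
    simp only [transpose_mul, diagonal_transpose, transpose_transpose]
    calc _ = (q * qᵀ) * (diagonal (e 0) * (N * Nᵀ) * diagonal (e 0)) * (q * qᵀ) := by
          simp only [mul_assoc]
      _ = _ := by rw [hqq, one_mul, mul_one]
  refine Set.mem_iUnion.mpr ⟨fun p => SignType.sign (e 0 p.1.1) * SignType.sign (e 0 p.1.2),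
    fun l => e l.succ, fun i => ?_, ?_⟩
  · have := hpos.diag_pos (i := i)
    rw [hY, mul_diagonal, diagonal_mul] at this
    rw [← hN]
    nlinarith [sq_nonneg (e 0 i)]
  · funext p
    rw [hY, corr_diagonal_mul_mul_diagonal]
    simp [hN]

theorem contDiff_layerProdInv_apply {X : Type*} [NormedAddCommGroup X] [NormedSpace ℝ X] (L : ℕ)
    (Q : Fin L → Matrix.orthogonalGroup (Fin D) ℝ) (e : X → Fin L → Fin D → ℝ)
    (he : ContDiff ℝ 1 e) (i j : Fin D) :
    ContDiff ℝ 1 fun x => layerProdInv L Q (e x) i j := by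
  induction L generalizing i j with
  | zero => simpa [layerProdInv] using contDiff_const
  | succ L ih =>
    simp only [layerProdInv_succ]
    simp only [mul_apply (M := _ * diagonal _), mul_diagonal, transpose_apply]
    have h0 : ∀ l k, ContDiff ℝ 1 fun x => e x l k := fun l k =>
      contDiff_pi.mp (contDiff_pi.mp he l) k
    refine ContDiff.sum fun k _ => ?_
    exact ((contDiff_const.mul (h0 0 k))).mul (ih _ (fun x l => e x l.succ)
      (contDiff_pi.mpr fun l => contDiff_pi.mp he l.succ) _ _)

theorem ContDiffAt.corr {X : Type*} [NormedAddCommGroup X] [NormedSpace ℝ X]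
    {Y : X → Matrix (Fin D) (Fin D) ℝ} {x : X} (hY : ∀ i j, ContDiffAt ℝ 1 (fun x => Y x i j) x)
    (hpos : ∀ i, 0 < Y x i i) : ContDiffAt ℝ 1 (fun x => corr (Y x)) x := by
  refine contDiffAt_pi.mpr fun p => ?_
  have h : ∀ i, ContDiffAt ℝ 1 (fun x => √(Y x i i)) x := fun i =>
    (hY i i).sqrt (hpos i).ne'
  exact (hY _ _).div ((h _).mul (h _))
    (mul_ne_zero (Real.sqrt_ne_zero'.mpr (hpos _)) (Real.sqrt_ne_zero'.mpr (hpos _)))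

/-! ### Null sets under smooth maps and along lines -/

/-- The image of a lower-dimensional space under a `C¹` map is a null set. -/
theorem volume_image_eq_zero_of_finrank_lt {X ι : Type*} [NormedAddCommGroup X] [NormedSpace ℝ X]
    [FiniteDimensional ℝ X] [Fintype ι] {f : X → ι → ℝ} {s : Set X}
    (hf : ∀ x ∈ s, ContDiffAt ℝ 1 f x) (hd : Module.finrank ℝ X < Fintype.card ι) :
    volume (f '' s) = 0 := by
  have : SecondCountableTopology X := by
    have := FiniteDimensional.proper_real X
    infer_instance
  have h1 : dimH (f '' s) ≤ dimH s := dimH_image_le_of_locally_lipschitzOn fun x hx => by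
    obtain ⟨K, t, ht, h⟩ := (hf x hx).exists_lipschitzOnWith
    exact ⟨K, t, mem_nhdsWithin_of_mem_nhds ht, h⟩
  have h2 : dimH (f '' s) < ((Fintype.card ι : NNReal) : ENNReal) := by
    refine (h1.trans (dimH_mono (Set.subset_univ s))).trans_lt ?_
    rw [Real.dimH_univ_eq_finrank]
    exact_mod_cast hd
  have h3 := hausdorffMeasure_of_dimH_lt h2
  rw [← hausdorffMeasure_pi_real]
  simpa using h3

/-- There are finitely many sign patterns, and for each one a `C¹` image of an `L * D`-dimensional
parameter set. Positive diagonal entries keep the square roots in `corr` smooth. -/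
theorem volume_layerCorrSet {L : ℕ} (h : L * D < Fintype.card (UpperPairs D))
    (Q : Fin L → Matrix.orthogonalGroup (Fin D) ℝ) : volume (layerCorrSet L Q) = 0 := by
  refine measure_iUnion_null fun s => ?_
  refine volume_image_eq_zero_of_finrank_lt (fun e he => ?_)
    (by simpa [Module.finrank_pi_fintype] using h)
  have hY : ∀ i j, ContDiffAt ℝ 1
      (fun e => (layerProdInv L Q e * (layerProdInv L Q e)ᵀ) i j) e := fun i j => by
    simp only [mul_apply, transpose_apply]
    exact (ContDiff.sum fun k _ => (contDiff_layerProdInv_apply L Q _ contDiff_id _ _).mul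
      (contDiff_layerProdInv_apply L Q _ contDiff_id _ _)).contDiffAt
  exact contDiffAt_pi.mpr fun p => contDiffAt_const.mul
    (contDiffAt_pi.mp (ContDiffAt.corr hY he) p)

/-- A `C¹` map pulls null sets back to null sets near points where its derivative is injective. -/
theorem volume_inter_preimage_eq_zero {ι : Type*} [Fintype ι] {f : (ι → ℝ) → ι → ℝ}
    {s N : Set (ι → ℝ)} (hf : ∀ x ∈ s, ContDiffAt ℝ 1 f x)
    (hinj : ∀ x ∈ s, ∀ v, fderiv ℝ f x v = 0 → v = 0) (hN : volume N = 0) :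
    volume (s ∩ f ⁻¹' N) = 0 := by
  refine measure_null_of_locally_null _ fun x hx => ?_
  have hinj' : LinearMap.ker (fderiv ℝ f x).toLinearMap = ⊥ :=
    LinearMap.ker_eq_bot'.mpr (hinj x hx.1)
  let f' : (ι → ℝ) ≃L[ℝ] (ι → ℝ) :=
    (LinearEquiv.ofInjectiveEndo _ (LinearMap.ker_eq_bot.mp hinj')).toContinuousLinearEquiv
  have hs : HasStrictFDerivAt f (f' : (ι → ℝ) →L[ℝ] (ι → ℝ)) x := by
    have h1 := (hf x hx.1).hasStrictFDerivAt one_ne_zero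
    have h2 : (f' : (ι → ℝ) →L[ℝ] (ι → ℝ)) = fderiv ℝ f x := by ext1 v; rfl
    rwa [h2]
  -- Near `x`, the preimage of `N` lies in the image of `N` under the local inverse, which is
  -- Lipschitz and so preserves null sets.
  obtain ⟨K, t, ht, hK⟩ := hs.to_localInverse.exists_lipschitzOnWith
  have hnull : volume (hs.localInverse f f' x '' (t ∩ N)) = 0 := by
    have h0 : volume (t ∩ N) = 0 := measure_mono_null Set.inter_subset_right hN
    rw [← hausdorffMeasure_pi_real] at h0 ⊢
    have := (hK.mono Set.inter_subset_left (s := t ∩ N)).hausdorffMeasure_image_le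
      (d := Fintype.card ι) (by positivity)
    rw [h0, mul_zero] at this
    exact le_antisymm this (zero_le)
  refine ⟨(s ∩ f ⁻¹' N) ∩ ({y | hs.localInverse f f' x (f y) = y} ∩ f ⁻¹' t),
    inter_mem self_mem_nhdsWithin (mem_nhdsWithin_of_mem_nhds
      (inter_mem hs.eventually_left_inverse ((hf x hx.1).continuousAt ht))),
    measure_mono_null ?_ hnull⟩
  rintro y ⟨⟨-, hyN⟩, hy, hyt⟩
  exact ⟨f y, ⟨hyt, hyN⟩, hy⟩

/-- A closed set that meets every line through some point in a countable set is null. -/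
theorem measure_eq_zero_of_countable_lines {E : Type*} [NormedAddCommGroup E] [NormedSpace ℝ E]
    [FiniteDimensional ℝ E] [MeasurableSpace E] [BorelSpace E] (μ : Measure E) [μ.IsAddHaarMeasure]
    {s : Set E} (hs : IsClosed s) (x : E) (h : ∀ v, {t : ℝ | x + t • v ∈ s}.Countable) :
    μ s = 0 := by
  have : SecondCountableTopology E := by
    have := FiniteDimensional.proper_real E
    infer_instance
  have hP : MeasurableSet {p : E × ℝ | x + p.2 • p.1 ∈ s} :=
    (hs.preimage (by fun_prop : Continuous fun p : E × ℝ => x + p.2 • p.1)).measurableSet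
  have h1 : (μ.prod volume) {p : E × ℝ | x + p.2 • p.1 ∈ s} = 0 := by
    rw [Measure.measure_prod_null hP]
    exact Eventually.of_forall fun v => (h v).measure_zero _
  -- Exchange the roles of `v` and `t`: some single `t ≠ 0` has a null set of directions `v` with `x
  -- + t • v ∈ s`, and this set is an affine copy of `s`.
  rw [← Measure.prod_swap, Measure.map_apply measurable_swap hP] at h1
  have h2 := Measure.measure_ae_null_of_prod_null h1
  have h3 : ∀ᵐ t : ℝ, t ≠ 0 := by simp [ae_iff]
  obtain ⟨t, ht, ht0⟩ := (h2.and h3).exists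
  have h4 : μ ((t • ·) ⁻¹' ((x + ·) ⁻¹' s)) = 0 := ht
  rw [Measure.addHaar_preimage_smul μ ht0, measure_preimage_add] at h4
  rcases mul_eq_zero.mp h4 with h | h
  · have := ENNReal.ofReal_eq_zero.mp h
    exact absurd this (not_le.mpr (by positivity))
  · exact h

/-! ### Skew-symmetric matrices and the Cayley transform -/

/-- Some choice of signs `±1` on the diagonal makes `diagonal s + X` invertible. -/
theorem exists_sign_det_diagonal_add_ne_zero {n : Type*} [Fintype n] [DecidableEq n]
    (X : Matrix n n ℝ) : ∃ s : n → ℝ, (∀ i, s i = 1 ∨ s i = -1) ∧ (diagonal s + X).det ≠ 0 := by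
  by_contra! hcon
  -- The determinant is affine in each diagonal entry, so vanishing at `±1` frees the entries one at
  -- a time; `t` is the set of freed entries.
  have key : ∀ t : Finset n, ∀ s : n → ℝ, (∀ i ∉ t, s i = 1 ∨ s i = -1) →
      (diagonal s + X).det = 0 := by
    intro t
    induction t using Finset.induction_on with
    | empty => exact fun s hs => hcon s fun i => hs i (Finset.notMem_empty i)
    | insert k t hk ih =>
      intro s hs
      have haff : ∃ a b : ℝ, ∀ x : ℝ, (diagonal (Function.update s k x) + X).det = a + x * b := by
        refine ⟨((diagonal s + X).updateRow k (X k)).det,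
          ((diagonal s + X).updateRow k (Pi.single k 1)).det, fun x => ?_⟩
        rw [← det_updateRow_smul, ← det_updateRow_add]
        congr 1
        ext i j
        by_cases hi : i = k
        · subst hi
          simp only [updateRow_self, Matrix.add_apply, Pi.add_apply, Pi.smul_apply, smul_eq_mul,
            diagonal_apply, Function.update_self, Pi.single_apply]
          by_cases hj : i = j
          · subst hj; simp; ring
          · simp [hj, Ne.symm hj]
        · simp [updateRow_ne hi, diagonal_apply, Function.update_of_ne hi]
      obtain ⟨a, b, hab⟩ := haff
      have hx : ∀ x : ℝ, (x = 1 ∨ x = -1) → a + x * b = 0 := fun x hx => by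
        rw [← hab]
        refine ih _ fun i hi => ?_
        by_cases hik : i = k
        · subst hik; simpa using hx
        · rw [Function.update_of_ne hik]
          exact hs i (by simp [hik, hi])
      have h1 := hx 1 (Or.inl rfl)
      have h2 := hx (-1) (Or.inr rfl)
      have := hab (s k)
      rw [Function.update_eq_self] at this
      rw [this, show a = 0 by linarith, show b = 0 by linarith]
      simp
  have h := key Finset.univ
  have hp : (-X).charpoly = 0 := by
    refine Polynomial.funext fun x => ?_
    rw [eval_charpoly, Polynomial.eval_zero, ← h (fun _ => x) (by simp)]
    congr 1
    rw [sub_neg_eq_add]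
    rfl
  exact (charpoly_monic (-X)).ne_zero hp

/-- The skew-symmetric matrix with the given entries above the diagonal. -/
def skewOf (a : UpperPairs D → ℝ) : Matrix (Fin D) (Fin D) ℝ := fun i j =>
  if h : i < j then a ⟨(i, j), h⟩ else if h : j < i then -a ⟨(j, i), h⟩ else 0

theorem skewOf_transpose (a : UpperPairs D → ℝ) : (skewOf a)ᵀ = -skewOf a := by
  ext i j
  simp only [transpose_apply, Matrix.neg_apply, skewOf]
  rcases lt_trichotomy i j with h | rfl | h
  · simp [h, h.not_gt]
  · simp
  · simp [h, h.not_gt]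

theorem skewOf_add_smul (a v : UpperPairs D → ℝ) (t : ℝ) :
    skewOf (a + t • v) = skewOf a + t • skewOf v := by
  ext i j
  simp only [Matrix.add_apply, Matrix.smul_apply, skewOf, Pi.add_apply, Pi.smul_apply, smul_eq_mul]
  split_ifs <;> ring

theorem skewOf_injective : Function.Injective (skewOf (D := D)) := by
  intro a b h
  funext p
  have := congrFun (congrFun h p.1.1) p.1.2
  simpa [skewOf, p.2] using this

theorem exists_skewOf_eq {A : Matrix (Fin D) (Fin D) ℝ} (h : Aᵀ = -A) : ∃ a, skewOf a = A := by
  refine ⟨fun p => A p.1.1 p.1.2, ?_⟩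
  have h' : ∀ i j, A j i = -A i j := fun i j => congrFun (congrFun h i) j
  ext i j
  simp only [skewOf]
  rcases lt_trichotomy i j with hij | rfl | hij
  · simp [hij]
  · have := h' i i
    simp; linarith
  · simp [hij, hij.not_gt, h' i j]

/-- Skewness gives `v ⬝ᵥ A v = 0`, so a kernel vector of `1 + A` satisfies `v ⬝ᵥ v = 0`. -/
theorem det_one_add_ne_zero_of_skew {A : Matrix (Fin D) (Fin D) ℝ} (h : Aᵀ = -A) :
    (1 + A).det ≠ 0 := by
  intro h0
  obtain ⟨v, hv, hv0⟩ := exists_mulVec_eq_zero_iff.mpr h0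
  have h1 : v ⬝ᵥ (A *ᵥ v) = 0 := by
    have : v ⬝ᵥ (A *ᵥ v) = -(v ⬝ᵥ (A *ᵥ v)) := by
      conv_lhs => rw [dotProduct_mulVec, ← mulVec_transpose, h, neg_mulVec, neg_dotProduct,
        dotProduct_comm]
    linarith
  have h2 : v ⬝ᵥ ((1 + A) *ᵥ v) = v ⬝ᵥ v := by
    rw [add_mulVec, one_mulVec, dotProduct_add, h1, add_zero]
  rw [hv0, dotProduct_zero] at h2
  exact hv (dotProduct_self_eq_zero.mp h2.symm)

/-- The Cayley transform of a skew-symmetric matrix. -/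
noncomputable def cayley (A : Matrix (Fin D) (Fin D) ℝ) : Matrix (Fin D) (Fin D) ℝ :=
  (1 - A) * (1 + A)⁻¹

theorem cayley_mul_one_add {A : Matrix (Fin D) (Fin D) ℝ} (h : Aᵀ = -A) :
    cayley A * (1 + A) = 1 - A := by
  rw [cayley, mul_assoc, nonsing_inv_mul _ (det_one_add_ne_zero_of_skew h).isUnit, mul_one]

theorem cayley_mem_orthogonalGroup {A : Matrix (Fin D) (Fin D) ℝ} (h : Aᵀ = -A) :
    cayley A ∈ Matrix.orthogonalGroup (Fin D) ℝ := by
  rw [mem_orthogonalGroup_iff]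
  have hd := (det_one_add_ne_zero_of_skew h).isUnit
  have hd' : IsUnit (1 - A).det := by
    rw [← det_transpose, transpose_sub, transpose_one, h, sub_neg_eq_add]; exact hd
  have hc : (1 + A)⁻¹ * (1 - A)⁻¹ = (1 - A)⁻¹ * (1 + A)⁻¹ := by
    rw [← Matrix.mul_inv_rev, ← Matrix.mul_inv_rev]
    congr 1
    noncomm_ring
  change cayley A * (cayley A)ᵀ = 1
  rw [cayley, transpose_mul, transpose_nonsing_inv, transpose_add, transpose_sub, transpose_one, h,
    sub_neg_eq_add, ← sub_eq_add_neg]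
  calc (1 - A) * (1 + A)⁻¹ * ((1 - A)⁻¹ * (1 + A))
      = (1 - A) * ((1 + A)⁻¹ * (1 - A)⁻¹) * (1 + A) := by simp only [mul_assoc]
    _ = ((1 - A) * (1 - A)⁻¹) * ((1 + A)⁻¹ * (1 + A)) := by rw [hc]; simp only [mul_assoc]
    _ = 1 := by rw [mul_nonsing_inv _ hd', nonsing_inv_mul _ hd, one_mul]

/-- An orthogonal matrix without eigenvalue `-1` is a Cayley transform. -/
theorem exists_cayley_eq {H : Matrix (Fin D) (Fin D) ℝ} (hH : H * Hᵀ = 1)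
    (hdet : (1 + H).det ≠ 0) : ∃ a, cayley (skewOf a) = H := by
  have hu := hdet.isUnit
  have hHH : Hᵀ * H = 1 := mul_eq_one_comm.mp hH
  -- The Cayley transform is an involution, so the same formula inverts it.
  set A := (1 + H)⁻¹ * (1 - H) with hA
  have h1 : (1 + H) * A = 1 - H := by rw [hA, ← mul_assoc, mul_nonsing_inv _ hu, one_mul]
  have hut : IsUnit (1 + Hᵀ).det := by
    rw [← transpose_one, ← transpose_add, det_transpose]; exact hu
  have hcomm : A * (1 + H) = 1 - H := by
    have : (1 + H)⁻¹ * ((1 - H) * (1 + H)) = (1 + H)⁻¹ * ((1 + H) * (1 - H)) := by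
      congr 1; noncomm_ring
    rw [hA, mul_assoc, this, ← mul_assoc, nonsing_inv_mul _ hu, one_mul]
  have hskew : Aᵀ = -A := by
    have h2 : Aᵀ * (1 + Hᵀ) = 1 - Hᵀ := by
      have := congrArg transpose h1
      simpa [transpose_mul] using this
    have h3 : (-A) * (1 + Hᵀ) = 1 - Hᵀ := by
      have h4 : (1 + Hᵀ) = (1 + H) * Hᵀ := by rw [add_mul, one_mul, hH, add_comm]
      rw [h4, neg_mul, ← mul_assoc, hcomm, sub_mul, one_mul, hH]
      noncomm_ring
    have h5 : Aᵀ * (1 + Hᵀ) = (-A) * (1 + Hᵀ) := h2.trans h3.symm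
    calc Aᵀ = Aᵀ * (1 + Hᵀ) * (1 + Hᵀ)⁻¹ := by rw [mul_assoc, mul_nonsing_inv _ hut, mul_one]
      _ = -A := by rw [h5, mul_assoc, mul_nonsing_inv _ hut, mul_one]
  obtain ⟨a, ha⟩ := exists_skewOf_eq hskew
  refine ⟨a, ?_⟩
  rw [ha]
  have hua := (det_one_add_ne_zero_of_skew hskew).isUnit
  have h6 : H * (1 + A) = 1 - A := by
    have : H * A + A = 1 - H := by rw [← h1]; noncomm_ring
    rw [mul_add, mul_one, ← sub_eq_zero]
    rw [← sub_eq_zero] at this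
    rw [← this]; abel
  calc cayley A = H * (1 + A) * (1 + A)⁻¹ := by rw [h6, cayley]
    _ = H := by rw [mul_assoc, mul_nonsing_inv _ hua, mul_one]

/-! ### Transversality of conjugation and rescaling -/

/-- Infinitesimal rescaling of the coordinates is transversal to the orbit of a covariance matrix
with simple spectrum under conjugation, if the squared entries of its eigenbasis form an invertible
matrix. -/
theorem eq_zero_of_commutator_eq_rescaling {U Ω : Matrix (Fin D) (Fin D) ℝ} {lam τ : Fin D → ℝ}
    (hU : U * Uᵀ = 1) (hlam : ∀ i, 0 < lam i) (hinj : Function.Injective lam)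
    (hdet : (U ⊙ U).det ≠ 0) (hΩ : Ωᵀ = -Ω)
    (h : Ω * (U * diagonal lam * Uᵀ) - (U * diagonal lam * Uᵀ) * Ω =
      diagonal τ * (U * diagonal lam * Uᵀ) + (U * diagonal lam * Uᵀ) * diagonal τ) : Ω = 0 := by
  have hU' : Uᵀ * U = 1 := mul_eq_one_comm.mp hU
  set Ω' := Uᵀ * Ω * U with hΩ'
  set T := Uᵀ * diagonal τ * U with hT
  have h1 : Ω' * diagonal lam - diagonal lam * Ω' = T * diagonal lam + diagonal lam * T := by
    have e1 : ∀ Z : Matrix (Fin D) (Fin D) ℝ, Uᵀ * (Z * (U * diagonal lam * Uᵀ)) * U =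
        Uᵀ * Z * U * diagonal lam := fun Z => by
      calc _ = Uᵀ * Z * U * diagonal lam * (Uᵀ * U) := by simp only [mul_assoc]
        _ = _ := by rw [hU', mul_one]
    have e2 : ∀ Z : Matrix (Fin D) (Fin D) ℝ, Uᵀ * ((U * diagonal lam * Uᵀ) * Z) * U =
        diagonal lam * (Uᵀ * Z * U) := fun Z => by
      calc _ = (Uᵀ * U) * diagonal lam * (Uᵀ * Z * U) := by simp only [mul_assoc]
        _ = _ := by rw [hU', one_mul]
    have := congrArg (fun Z => Uᵀ * Z * U) h
    simpa only [mul_sub, sub_mul, mul_add, add_mul, e1, e2] using this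
  -- In the eigenbasis, `Ω' k l (lam l - lam k) = T k l (lam l + lam k)`. The diagonal entries give
  -- `T k k = ∑ i, τ i U i k ² = 0`, so `τ = 0`; then the simple spectrum kills `Ω'` off the
  -- diagonal.
  have hent : ∀ k l, Ω' k l * lam l - lam k * Ω' k l = T k l * lam l + lam k * T k l := fun k l => by
    have := congrFun (congrFun h1 k) l
    simpa [mul_diagonal, diagonal_mul] using this
  have hTk : ∀ k, T k k = 0 := fun k => by
    have := hent k k
    have h2 := hlam k
    have h3 : lam k * T k k = 0 := by linarith
    exact (mul_eq_zero.mp h3).resolve_left h2.ne'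
  have hτ : τ = 0 := by
    refine eq_zero_of_vecMul_eq_zero hdet ?_
    funext k
    have := hTk k
    rw [hT, mul_apply] at this
    simp only [mul_diagonal, transpose_apply] at this
    simp only [vecMul, dotProduct, hadamard_apply, Pi.zero_apply]
    rw [← this]
    exact Finset.sum_congr rfl fun i _ => by ring
  have hT0 : T = 0 := by rw [hT, hτ]; simp
  have hΩ'T : Ω'ᵀ = -Ω' := by simp [hΩ', transpose_mul, hΩ, mul_assoc]
  have hΩ0 : Ω' = 0 := by
    ext k l
    by_cases hkl : k = l
    · subst hkl
      have : Ω' k k = -Ω' k k := congrFun (congrFun hΩ'T k) k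
      simp; linarith
    · have := hent k l
      rw [hT0] at this
      have h3 : Ω' k l * (lam l - lam k) = 0 := by simp at this; linarith
      exact (mul_eq_zero.mp h3).resolve_right
        (sub_ne_zero.mpr fun h => hkl (hinj h).symm)
  calc Ω = (U * Uᵀ) * Ω * (U * Uᵀ) := by rw [hU, one_mul, mul_one]
    _ = U * Ω' * Uᵀ := by simp only [hΩ', mul_assoc]
    _ = 0 := by rw [hΩ0]; simp

/-! ### Derivatives of the Cayley transform and of correlations -/

/-- Entrywise derivative at `0` of a curve of matrices. -/
def HasEntryDeriv {n : Type*} (M : ℝ → Matrix n n ℝ) (M' : Matrix n n ℝ) : Prop :=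
  ∀ i j, HasDerivAt (fun t => M t i j) (M' i j) 0

namespace HasEntryDeriv

variable {n : Type*} {M N : ℝ → Matrix n n ℝ} {M' N' : Matrix n n ℝ}

theorem mul [Fintype n] (hM : HasEntryDeriv M M') (hN : HasEntryDeriv N N') :
    HasEntryDeriv (fun t => M t * N t) (M' * N 0 + M 0 * N') := fun i j => by
  simp only [mul_apply, Matrix.add_apply, ← Finset.sum_add_distrib]
  exact HasDerivAt.fun_sum fun k _ => (hM i k).mul (hN k j)

theorem transpose (hM : HasEntryDeriv M M') : HasEntryDeriv (fun t => (M t)ᵀ) M'ᵀ :=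
  fun i j => hM j i

theorem const (X : Matrix n n ℝ) : HasEntryDeriv (fun _ => X) 0 := fun _ _ => hasDerivAt_const _ _

theorem unique (hM : HasEntryDeriv M M') (hM2 : HasEntryDeriv M N') : M' = N' := by
  ext i j; exact (hM i j).unique (hM2 i j)

theorem add (hM : HasEntryDeriv M M') (hN : HasEntryDeriv N N') :
    HasEntryDeriv (fun t => M t + N t) (M' + N') := fun i j => (hM i j).add (hN i j)

theorem sub (hM : HasEntryDeriv M M') (hN : HasEntryDeriv N N') :
    HasEntryDeriv (fun t => M t - N t) (M' - N') := fun i j => (hM i j).sub (hN i j)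

end HasEntryDeriv

theorem contDiff_det {X n : Type*} [NormedAddCommGroup X] [NormedSpace ℝ X] [Fintype n]
    [DecidableEq n] {M : X → Matrix n n ℝ} (hM : ∀ i j, ContDiff ℝ 1 fun x => M x i j) :
    ContDiff ℝ 1 fun x => (M x).det := by
  simp only [det_apply]
  exact ContDiff.sum fun σ _ => (contDiff_prod fun i _ => hM _ _).const_smul _

theorem contDiff_adjugate {X n : Type*} [NormedAddCommGroup X] [NormedSpace ℝ X] [Fintype n]
    [DecidableEq n] {M : X → Matrix n n ℝ} (hM : ∀ i j, ContDiff ℝ 1 fun x => M x i j) (i j : n) :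
    ContDiff ℝ 1 fun x => (M x).adjugate i j := by
  simp only [adjugate_apply]
  refine contDiff_det fun k l => ?_
  simp only [updateRow_apply]
  split_ifs
  · exact contDiff_const
  · exact hM k l

theorem contDiff_skewOf_apply (i j : Fin D) :
    ContDiff ℝ 1 fun a : UpperPairs D → ℝ => skewOf a i j := by
  simp only [skewOf]
  split_ifs <;> fun_prop

theorem contDiff_cayley_apply (i j : Fin D) :
    ContDiff ℝ 1 fun a : UpperPairs D → ℝ => cayley (skewOf a) i j := by
  have h1 : ∀ i j, ContDiff ℝ 1 fun a : UpperPairs D → ℝ => (1 + skewOf a) i j := fun i j =>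
    contDiff_const.add (contDiff_skewOf_apply i j)
  have h2 : ∀ i j, ContDiff ℝ 1 fun a : UpperPairs D → ℝ => (1 - skewOf a) i j := fun i j =>
    contDiff_const.sub (contDiff_skewOf_apply i j)
  simp only [cayley, inv_def, Ring.inverse_eq_inv', mul_apply, Matrix.smul_apply, smul_eq_mul]
  exact ContDiff.sum fun k _ => (h2 i k).mul (((contDiff_det h1).inv fun a =>
    det_one_add_ne_zero_of_skew (skewOf_transpose a)).mul (contDiff_adjugate h1 k j))

/-- The derivative of the Cayley transform is injective. -/
theorem eq_zero_of_hasEntryDeriv_cayley_zero {a v : UpperPairs D → ℝ}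
    (h : HasEntryDeriv (fun t : ℝ => cayley (skewOf (a + t • v))) 0) : v = 0 := by
  have hA : HasEntryDeriv (fun t : ℝ => skewOf (a + t • v)) (skewOf v) := fun i j => by
    simp only [skewOf_add_smul, Matrix.add_apply, Matrix.smul_apply, smul_eq_mul]
    simpa using ((hasDerivAt_id (0 : ℝ)).mul_const (skewOf v i j)).const_add (skewOf a i j)
  -- Differentiating `C (1 + A) = 1 - A` with `C' = 0` gives `(1 + C) A' = 0`, and `1 + C = 2 (1 +
  -- A)⁻¹` is invertible.
  have h1 := h.mul ((HasEntryDeriv.const 1).add hA)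
  have h2 : HasEntryDeriv (fun t : ℝ => cayley (skewOf (a + t • v)) * (1 + skewOf (a + t • v)))
      (0 - skewOf v) := by
    simp only [cayley_mul_one_add (skewOf_transpose _)]
    exact (HasEntryDeriv.const 1).sub hA
  have h3 := h1.unique h2
  simp only [zero_smul, add_zero, zero_mul, zero_add, zero_sub] at h3
  set A := skewOf a
  set C := cayley A
  have h4 : (1 + C) * skewOf v = 0 := by rw [add_mul, h3, one_mul, add_neg_cancel]
  have h5 : (1 + C) * (1 + A) = (2 : ℝ) • 1 := by
    rw [add_mul, cayley_mul_one_add (skewOf_transpose a), two_smul, one_mul]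
    abel
  have h6 : (1 + C) * ((2 : ℝ)⁻¹ • (1 + A)) = 1 := by
    rw [mul_smul_comm, h5, smul_smul]; norm_num
  have h7 : skewOf v = skewOf 0 := by
    have h0 : skewOf (0 : UpperPairs D → ℝ) = 0 := by
      ext i j; simp [skewOf]
    rw [h0, ← one_mul (skewOf v), ← mul_eq_one_comm.mp h6, mul_assoc, h4, mul_zero]
  exact skewOf_injective h7

theorem posDef_conj_diagonal {U : Matrix (Fin D) (Fin D) ℝ} (hU : U * Uᵀ = 1) {lam : Fin D → ℝ}
    (hlam : ∀ i, 0 < lam i) : (U * diagonal lam * Uᵀ).PosDef := by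
  rw [← conjTranspose_eq_transpose_of_trivial, ← star_eq_conjTranspose]
  exact (IsUnit.posDef_star_right_conjugate_iff (IsUnit.of_mul_eq_one _ hU)).mpr
    (posDef_diagonal_iff.mpr hlam)

/-- If the correlations of a curve of covariance matrices are stationary, its derivative is an
infinitesimal rescaling. -/
theorem exists_rescaling_of_corr_stationary {Y : ℝ → Matrix (Fin D) (Fin D) ℝ}
    {Y' : Matrix (Fin D) (Fin D) ℝ} (hY : HasEntryDeriv Y Y') (hpos : ∀ t i, 0 < Y t i i)
    (hsymm : ∀ t, (Y t)ᵀ = Y t) (hcorr : ∀ p, HasDerivAt (fun t => corr (Y t) p) 0 0) :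
    ∃ τ : Fin D → ℝ, Y' = diagonal τ * Y 0 + Y 0 * diagonal τ := by
  -- The logarithmic derivatives of the standard deviations `√(Y t i i)`.
  refine ⟨fun i => Y' i i / (2 * Y 0 i i), ?_⟩
  have hsY' : Y'ᵀ = Y' := hY.transpose.unique (by simpa only [hsymm] using hY)
  have hlt : ∀ i j, i < j → Y' i j =
      (Y' i i / (2 * Y 0 i i) + Y' j j / (2 * Y 0 j j)) * Y 0 i j := fun i j hij => by
    have hs : ∀ k, HasDerivAt (fun t => √(Y t k k)) (Y' k k / (2 * √(Y 0 k k))) 0 := fun k =>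
      (hY k k).sqrt (hpos 0 k).ne'
    have hne : ∀ t k, √(Y t k k) ≠ 0 := fun t k => Real.sqrt_ne_zero'.mpr (hpos t k)
    have h1 := (hcorr ⟨(i, j), hij⟩).mul ((hs i).mul (hs j))
    have h2 : ∀ t, Y t i j = corr (Y t) ⟨(i, j), hij⟩ * (√(Y t i i) * √(Y t j j)) := fun t => by
      have := hne t i; have := hne t j
      simp only [corr]; field_simp
    have h3 : HasDerivAt (fun t => Y t i j) _ 0 := h1.congr_of_eventuallyEq
      (Eventually.of_forall fun t => h2 t)
    rw [(hY i j).unique h3, h2 0]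
    simp only [Pi.mul_apply]
    have hi := hne 0 i; have hj := hne 0 j
    have hi2 : Y 0 i i = √(Y 0 i i) ^ 2 := (Real.sq_sqrt (hpos 0 i).le).symm
    have hj2 : Y 0 j j = √(Y 0 j j) ^ 2 := (Real.sq_sqrt (hpos 0 j).le).symm
    set si := √(Y 0 i i)
    set sj := √(Y 0 j j)
    rw [hi2, hj2]
    field_simp
    ring
  ext i j
  simp only [Matrix.add_apply, diagonal_mul, mul_diagonal]
  rcases lt_trichotomy i j with h | rfl | h
  · rw [hlt i j h]; ring
  · have := (hpos 0 i).ne'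
    field_simp
    ring
  · have h1 : Y' i j = Y' j i := congrFun (congrFun hsY' j) i
    have h2 : Y 0 i j = Y 0 j i := congrFun (congrFun (hsymm 0) j) i
    rw [h1, hlt j i h, h2]; ring

/-! ### The correlation map in Cayley charts -/

section

variable {g : Matrix (Fin D) (Fin D) ℝ} {lam : Fin D → ℝ}

theorem cayley_mul_orthogonal (hg : g * gᵀ = 1) (a : UpperPairs D → ℝ) :
    (cayley (skewOf a) * g) * (cayley (skewOf a) * g)ᵀ = 1 := by
  have h1 := (mem_orthogonalGroup_iff _ _).mp (cayley_mem_orthogonalGroup (skewOf_transpose a))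
  rw [transpose_mul]
  calc _ = cayley (skewOf a) * (g * gᵀ) * (cayley (skewOf a))ᵀ := by simp only [mul_assoc]
    _ = 1 := by rw [hg, mul_one]; exact h1

theorem contDiff_cayley_conj_apply (i j : Fin D) : ContDiff ℝ 1 fun a : UpperPairs D → ℝ =>
    ((cayley (skewOf a) * g) * diagonal lam * (cayley (skewOf a) * g)ᵀ) i j := by
  have h1 : ∀ i j, ContDiff ℝ 1 fun a : UpperPairs D → ℝ => (cayley (skewOf a) * g) i j :=
    fun i j => by
      simp only [mul_apply]
      exact ContDiff.sum fun k _ => (contDiff_cayley_apply i k).mul contDiff_const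
  simp only [mul_apply (M := _ * diagonal lam), mul_diagonal, transpose_apply]
  exact ContDiff.sum fun k _ => ((h1 i k).mul contDiff_const).mul (h1 j k)

theorem contDiff_corr_cayley_conj (hg : g * gᵀ = 1) (hlam : ∀ i, 0 < lam i)
    (a : UpperPairs D → ℝ) : ContDiffAt ℝ 1 (fun a : UpperPairs D → ℝ =>
      corr ((cayley (skewOf a) * g) * diagonal lam * (cayley (skewOf a) * g)ᵀ)) a :=
  ContDiffAt.corr (fun i j => (contDiff_cayley_conj_apply i j).contDiffAt)
    fun _ => (posDef_conj_diagonal (cayley_mul_orthogonal hg a) hlam).diag_pos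

/-- The orthogonal curve `C t` has velocity `Ω C` with `Ω` skew, so the covariance moves by the
commutator with `Ω`. Stationary correlations make this a rescaling; transversality gives `Ω = 0`, so
the Cayley transform is stationary and `v = 0`. -/
theorem fderiv_corr_cayley_conj_injective (hg : g * gᵀ = 1) (hlam : ∀ i, 0 < lam i)
    (hinj : Function.Injective lam) {a : UpperPairs D → ℝ}
    (hdet : ((cayley (skewOf a) * g) ⊙ (cayley (skewOf a) * g)).det ≠ 0) (v : UpperPairs D → ℝ)
    (hv : fderiv ℝ (fun a : UpperPairs D → ℝ =>
      corr ((cayley (skewOf a) * g) * diagonal lam * (cayley (skewOf a) * g)ᵀ)) a v = 0) :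
    v = 0 := by
  have hline : HasDerivAt (fun t : ℝ => a + t • v) v 0 := by
    simpa using ((hasDerivAt_id (0 : ℝ)).smul_const v).const_add a
  have hline0 : a + (0 : ℝ) • v = a := by simp
  set C : ℝ → Matrix (Fin D) (Fin D) ℝ := fun t => cayley (skewOf (a + t • v)) with hC
  have hCe : ∃ C', HasEntryDeriv C C' := by
    refine ⟨fun i j => fderiv ℝ (fun a => cayley (skewOf a) i j) a v, fun i j => ?_⟩
    have h1 := ((contDiff_cayley_apply (D := D) i j).differentiable one_ne_zero a).hasFDerivAt
    rw [← hline0] at h1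
    have := h1.comp_hasDerivAt (0 : ℝ) hline
    rwa [hline0] at this
  obtain ⟨C', hC'⟩ := hCe
  have hCC : ∀ t, C t * (C t)ᵀ = 1 := fun t =>
    (mem_orthogonalGroup_iff _ _).mp (cayley_mem_orthogonalGroup (skewOf_transpose _))
  have hCC' : ∀ t, (C t)ᵀ * C t = 1 := fun t => mul_eq_one_comm.mp (hCC t)
  set Ω := C' * (C 0)ᵀ with hΩ
  have hΩT : Ωᵀ = -Ω := by
    have h1 := hC'.mul hC'.transpose
    simp only [hCC] at h1
    have h2 := h1.unique (HasEntryDeriv.const 1)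
    rw [hΩ, transpose_mul, transpose_transpose]
    exact eq_neg_of_add_eq_zero_right h2
  set U : ℝ → Matrix (Fin D) (Fin D) ℝ := fun t => C t * g with hUdef
  have hUU : ∀ t, U t * (U t)ᵀ = 1 := fun t => cayley_mul_orthogonal hg _
  have hC'Ω : C' = Ω * C 0 := by rw [hΩ, mul_assoc, hCC', mul_one]
  have hU' : HasEntryDeriv U (Ω * U 0) := by
    have := hC'.mul (HasEntryDeriv.const g)
    rw [mul_zero, add_zero] at this
    rwa [hC'Ω, mul_assoc] at this
  set Y : ℝ → Matrix (Fin D) (Fin D) ℝ := fun t => U t * diagonal lam * (U t)ᵀ with hYdef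
  have hY' : HasEntryDeriv Y (Ω * Y 0 - Y 0 * Ω) := by
    have h1 := (hU'.mul (HasEntryDeriv.const (diagonal lam))).mul hU'.transpose
    convert h1 using 1
    rw [mul_zero, add_zero, transpose_mul Ω, hΩT]
    simp only [hYdef, mul_assoc, mul_neg, sub_eq_add_neg]
  have hpd : ∀ t, (Y t).PosDef := fun t => posDef_conj_diagonal (hUU t) hlam
  obtain ⟨τ, hτ⟩ := exists_rescaling_of_corr_stationary hY' (fun t i => (hpd t).diag_pos)
    (fun t => by simp [hYdef, transpose_mul, mul_assoc]) (fun p => by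
      have h1 := ((contDiff_corr_cayley_conj hg hlam a).differentiableAt one_ne_zero).hasFDerivAt
      rw [← hline0] at h1
      have h2 := h1.comp_hasDerivAt (0 : ℝ) hline
      rw [hline0, hv] at h2
      exact hasDerivAt_pi.mp h2 p)
  have hU0 : U 0 = cayley (skewOf a) * g := by simp [hUdef, hC]
  have hΩ0 : Ω = 0 := eq_zero_of_commutator_eq_rescaling (hUU 0) hlam hinj
    (by rw [hU0]; exact hdet) hΩT hτ
  rw [hC'Ω, hΩ0, zero_mul] at hC'
  exact eq_zero_of_hasEntryDeriv_cayley_zero hC'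

/-- For almost every skew-symmetric matrix, the squared entries of the translated Cayley transform
form an invertible matrix. -/
theorem volume_det_hadamard_cayley_eq_zero (hg : g * gᵀ = 1) :
    volume {a : UpperPairs D → ℝ |
      ((cayley (skewOf a) * g) ⊙ (cayley (skewOf a) * g)).det = 0} = 0 := by
  -- The adjugate clears the denominator, so that the determinant is polynomial in `a`.
  let V : (UpperPairs D → ℝ) → Matrix (Fin D) (Fin D) ℝ := fun a =>
    (1 - skewOf a) * (1 + skewOf a).adjugate * g
  have hV : ∀ a, ((V a) ⊙ (V a)).det = 0 ↔
      ((cayley (skewOf a) * g) ⊙ (cayley (skewOf a) * g)).det = 0 := fun a => by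
    have hd := det_one_add_ne_zero_of_skew (skewOf_transpose a)
    have h1 : V a = (1 + skewOf a).det • (cayley (skewOf a) * g) := by
      simp only [V, cayley, inv_def, Ring.inverse_eq_inv', mul_smul_comm, smul_mul_assoc, smul_smul]
      rw [mul_inv_cancel₀ hd, one_smul]
    rw [h1, smul_hadamard, hadamard_smul, smul_smul, det_smul, mul_eq_zero]
    exact or_iff_right (pow_ne_zero _ (mul_ne_zero hd hd))
  simp only [← hV]
  -- At `a₀` the matrix `cayley (skewOf a₀) * g` is `diagonal s`, whose Hadamard square is the
  -- identity. The signs are chosen so that `diagonal s * gᵀ` lies in the chart, i.e. has no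
  -- eigenvalue `-1`.
  obtain ⟨s, hs, hsdet⟩ := exists_sign_det_diagonal_add_ne_zero gᵀ
  have hss : diagonal s * diagonal s = 1 := by
    rw [diagonal_mul_diagonal, ← diagonal_one]
    congr 1; funext i
    rcases hs i with h | h <;> simp [h]
  obtain ⟨a₀, ha₀⟩ := exists_cayley_eq (H := diagonal s * gᵀ) (by
      rw [transpose_mul, transpose_transpose, diagonal_transpose]
      calc _ = diagonal s * (gᵀ * g) * diagonal s := by simp only [mul_assoc]
        _ = 1 := by rw [mul_eq_one_comm.mp hg, mul_one, hss]) (by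
      have : 1 + diagonal s * gᵀ = diagonal s * (diagonal s + gᵀ) := by rw [mul_add, hss]
      rw [this, det_mul]
      refine mul_ne_zero (fun h0 => ?_) hsdet
      have := congrArg det hss
      rw [det_mul, h0, zero_mul, det_one] at this
      exact zero_ne_one this)
  have hne : ((V a₀) ⊙ (V a₀)).det ≠ 0 := by
    rw [Ne, hV, ha₀, mul_assoc, mul_eq_one_comm.mp hg, mul_one, diagonal_hadamard_diagonal,
      det_diagonal, Finset.prod_eq_zero_iff]
    rintro ⟨i, -, hi⟩
    rcases hs i with h | h <;> norm_num [h] at hi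
  have hcont : Continuous fun a => ((V a) ⊙ (V a)).det := by
    have hA : Continuous fun a : UpperPairs D → ℝ => skewOf a :=
      continuous_matrix fun i j => (contDiff_skewOf_apply i j).continuous
    have hVc : Continuous V := by
      have := ((continuous_const (y := (1 : Matrix (Fin D) (Fin D) ℝ))).add hA).matrix_adjugate
      fun_prop
    refine Continuous.matrix_det (continuous_matrix fun i j => ?_)
    exact (hVc.matrix_elem i j).mul (hVc.matrix_elem i j)
  refine measure_eq_zero_of_countable_lines volume (isClosed_eq hcont continuous_const) a₀
    fun v => ?_
  -- along a line the determinant is a polynomial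
  let A : Matrix (Fin D) (Fin D) (Polynomial ℝ) :=
    (skewOf a₀).map Polynomial.C + (Polynomial.X : Polynomial ℝ) • (skewOf v).map Polynomial.C
  let W : Matrix (Fin D) (Fin D) (Polynomial ℝ) :=
    (1 - A) * (1 + A).adjugate * g.map Polynomial.C
  have hA : ∀ t : ℝ, (Polynomial.evalRingHom t).mapMatrix A = skewOf (a₀ + t • v) := fun t => by
    rw [skewOf_add_smul]
    ext i j
    simp [A]
    exact mul_comm _ _
  have hW : ∀ t : ℝ, (Polynomial.evalRingHom t).mapMatrix W = V (a₀ + t • v) := fun t => by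
    have hgm : (Polynomial.evalRingHom t).mapMatrix (g.map Polynomial.C) = g := by ext i j; simp
    simp only [W, V, map_mul, map_sub, map_one, RingHom.map_adjugate, map_add, hA, hgm]
  have hp : ∀ t : ℝ, (W ⊙ W).det.eval t = (V (a₀ + t • v) ⊙ V (a₀ + t • v)).det := fun t => by
    rw [← Polynomial.coe_evalRingHom, RingHom.map_det, ← hW]
    congr 1
    ext i j
    simp
  have hp0 : (W ⊙ W).det ≠ 0 := fun h0 => hne (by
    have := hp 0
    rw [h0] at this
    simpa using this.symm)
  refine Set.Countable.mono (fun t ht => ?_) ((W ⊙ W).det.roots.toFinset.countable_toSet)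
  have ht' : (V (a₀ + t • v) ⊙ V (a₀ + t • v)).det = 0 := ht
  simp only [Finset.mem_coe, Multiset.mem_toFinset, Polynomial.mem_roots hp0, Polynomial.IsRoot,
    hp, ht']

theorem volume_corr_cayley_mem (hg : g * gᵀ = 1) (hlam : ∀ i, 0 < lam i)
    (hinj : Function.Injective lam) {N : Set (UpperPairs D → ℝ)} (hN : volume N = 0) :
    volume {a : UpperPairs D → ℝ |
      corr ((cayley (skewOf a) * g) * diagonal lam * (cayley (skewOf a) * g)ᵀ) ∈ N} = 0 := by
  refine measure_mono_null ?_ (measure_union_null (volume_det_hadamard_cayley_eq_zero hg)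
    (volume_inter_preimage_eq_zero (s := {a | ((cayley (skewOf a) * g) ⊙
      (cayley (skewOf a) * g)).det ≠ 0}) (fun a _ => contDiff_corr_cayley_conj hg hlam a)
      (fun a ha v hv => fderiv_corr_cayley_conj_injective hg hlam hinj ha v hv) hN))
  intro a ha
  by_cases h : ((cayley (skewOf a) * g) ⊙ (cayley (skewOf a) * g)).det = 0
  · exact Or.inl h
  · exact Or.inr ⟨h, ha⟩

end

/-! ### Haar-null sets of rotations -/

instance orthogonalGroup_secondCountableTopology (D : ℕ) :
    SecondCountableTopology (Matrix.orthogonalGroup (Fin D) ℝ) := by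
  have : SecondCountableTopology (Matrix (Fin D) (Fin D) ℝ) :=
    inferInstanceAs (SecondCountableTopology (Fin D → Fin D → ℝ))
  exact TopologicalSpace.Subtype.secondCountableTopology _

instance haarOrthogonal_isMulLeftInvariant (D : ℕ) : (haarOrthogonal D).IsMulLeftInvariant :=
  inferInstanceAs (Measure.haarMeasure ⊤).IsMulLeftInvariant

/-- A measurable set is Haar-null if all its translates are null for some other nonzero measure. -/
theorem haarOrthogonal_eq_zero_of_translates {X : Type*} [MeasurableSpace X] (ν : Measure X)
    [SigmaFinite ν] [NeZero ν] {c : X → Matrix.orthogonalGroup (Fin D) ℝ} (hc : Measurable c)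
    {B : Set (Matrix.orthogonalGroup (Fin D) ℝ)} (hB : MeasurableSet B)
    (h : ∀ g, ν {x | c x * g ∈ B} = 0) : haarOrthogonal D B = 0 := by
  have hP : MeasurableSet {p : Matrix.orthogonalGroup (Fin D) ℝ × X | c p.2 * p.1 ∈ B} :=
    hB.preimage ((hc.comp measurable_snd).mul measurable_fst)
  have h1 : ((haarOrthogonal D).prod ν)
      {p : Matrix.orthogonalGroup (Fin D) ℝ × X | c p.2 * p.1 ∈ B} = 0 := by
    rw [Measure.measure_prod_null hP]
    exact Eventually.of_forall h
  -- By Fubini some `x` has a Haar-null set of `g` with `c x * g ∈ B`; left invariance transfers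
  -- this to `B`.
  rw [← Measure.prod_swap, Measure.map_apply measurable_swap hP] at h1
  obtain ⟨x, hx⟩ := (Measure.measure_ae_null_of_prod_null h1).exists
  have h2 : haarOrthogonal D ((c x * ·) ⁻¹' B) = 0 := hx
  rwa [measure_preimage_mul] at h2

theorem continuous_cayley_skewOf :
    Continuous fun a : UpperPairs D → ℝ => cayley (skewOf a) :=
  continuous_matrix fun i j => (contDiff_cayley_apply i j).continuous

theorem measurable_corr_conj (S : Matrix (Fin D) (Fin D) ℝ) :
    Measurable fun Q : Matrix.orthogonalGroup (Fin D) ℝ =>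
      corr ((Q : Matrix (Fin D) (Fin D) ℝ) * S * (Q : Matrix (Fin D) (Fin D) ℝ)ᵀ) := by
  have h : ∀ i j, Measurable fun Q : Matrix.orthogonalGroup (Fin D) ℝ =>
      ((Q : Matrix (Fin D) (Fin D) ℝ) * S * (Q : Matrix (Fin D) (Fin D) ℝ)ᵀ) i j := fun i j => by
    refine Continuous.measurable (Continuous.matrix_elem ?_ i j)
    fun_prop
  exact measurable_pi_lambda _ fun p => (h _ _).div ((h _ _).sqrt.mul (h _ _).sqrt)

/-- The correlations of a randomly rotated covariance with simple spectrum avoid null sets. -/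
theorem haarOrthogonal_corr_mem {S : Matrix (Fin D) (Fin D) ℝ} (hS : S.PosDef)
    (hinj : Function.Injective hS.isHermitian.eigenvalues) {N : Set (UpperPairs D → ℝ)}
    (hN : volume N = 0) :
    haarOrthogonal D {Q | corr ((Q : Matrix (Fin D) (Fin D) ℝ) * S *
      (Q : Matrix (Fin D) (Fin D) ℝ)ᵀ) ∈ N} = 0 := by
  set lam := hS.isHermitian.eigenvalues
  set V : Matrix (Fin D) (Fin D) ℝ := (hS.isHermitian.eigenvectorUnitary).1 with hV
  have hSV : S = V * diagonal lam * Vᵀ := by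
    have := hS.isHermitian.spectral_theorem
    rw [Unitary.conjStarAlgAut_apply] at this
    exact this
  have hVV : V * Vᵀ = 1 :=
    (mem_orthogonalGroup_iff _ _).mp hS.isHermitian.eigenvectorUnitary.2
  -- Fubini needs a measurable set, so `N` is replaced by a measurable null superset.
  refine measure_mono_null (t := {Q | corr ((Q : Matrix (Fin D) (Fin D) ℝ) * S *
    (Q : Matrix (Fin D) (Fin D) ℝ)ᵀ) ∈ toMeasurable volume N})
    (fun Q hQ => subset_toMeasurable _ _ hQ) ?_
  let c : (UpperPairs D → ℝ) → Matrix.orthogonalGroup (Fin D) ℝ := fun a =>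
    ⟨cayley (skewOf a), cayley_mem_orthogonalGroup (skewOf_transpose a)⟩
  have hc : Measurable c := (continuous_cayley_skewOf.subtype_mk _).measurable
  refine haarOrthogonal_eq_zero_of_translates volume hc
    ((measurableSet_toMeasurable _ _).preimage (measurable_corr_conj S)) fun g => ?_
  have hg : ((g : Matrix (Fin D) (Fin D) ℝ) * V) * ((g : Matrix (Fin D) (Fin D) ℝ) * V)ᵀ = 1 := by
    rw [transpose_mul]
    calc _ = (g : Matrix (Fin D) (Fin D) ℝ) * (V * Vᵀ) * (g : Matrix (Fin D) (Fin D) ℝ)ᵀ := by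
          simp only [mul_assoc]
      _ = 1 := by rw [hVV, mul_one]; exact (mem_orthogonalGroup_iff _ _).mp g.2
  refine measure_mono_null (fun a ha => ?_) (volume_corr_cayley_mem hg hS.eigenvalues_pos hinj
    (N := toMeasurable volume N) (by rw [measure_toMeasurable, hN]))
  have ha' : corr ((cayley (skewOf a) * (g : Matrix (Fin D) (Fin D) ℝ)) * S *
    (cayley (skewOf a) * (g : Matrix (Fin D) (Fin D) ℝ))ᵀ) ∈ toMeasurable volume N := ha
  rw [hSV] at ha'
  simp only [transpose_mul, mul_assoc, Set.mem_ofPred_eq] at ha' ⊢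
  exact ha'

/-! ### Fubini over the first rotation and conclusion -/

theorem continuous_layerProdInv (L : ℕ) :
    Continuous fun p : (Fin L → Matrix.orthogonalGroup (Fin D) ℝ) × (Fin L → Fin D → ℝ) =>
      layerProdInv L p.1 p.2 := by
  induction L with
  | zero => simpa [layerProdInv] using continuous_const
  | succ L ih =>
    simp only [layerProdInv_succ]
    have h1 := ih.comp (show Continuous fun p : (Fin (L + 1) → Matrix.orthogonalGroup (Fin D) ℝ) ×
      (Fin (L + 1) → Fin D → ℝ) => ((fun l => p.1 (Fin.succ l)), fun l => p.2 (Fin.succ l)) by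
        fun_prop)
    have h2 : Continuous fun p : (Fin (L + 1) → Matrix.orthogonalGroup (Fin D) ℝ) ×
      (Fin (L + 1) → Fin D → ℝ) => (p.1 0 : Matrix (Fin D) (Fin D) ℝ) := by fun_prop
    have h3 : Continuous fun p : (Fin (L + 1) → Matrix.orthogonalGroup (Fin D) ℝ) ×
      (Fin (L + 1) → Fin D → ℝ) => diagonal (p.2 0) :=
      Continuous.matrix_diagonal (by fun_prop)
    exact (h2.matrix_transpose.mul h3).mul h1

/-- The set of rotations that can linearly produce the covariance `S` is measurable. -/
theorem measurableSet_exists_layerProdInv (L : ℕ) (S : Matrix (Fin D) (Fin D) ℝ) :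
    MeasurableSet {Q : Fin L → Matrix.orthogonalGroup (Fin D) ℝ |
      ∃ e, S = layerProdInv L Q e * (layerProdInv L Q e)ᵀ} := by
  have hcl : IsClosed {p : (Fin L → Matrix.orthogonalGroup (Fin D) ℝ) × (Fin L → Fin D → ℝ) |
      S = layerProdInv L p.1 p.2 * (layerProdInv L p.1 p.2)ᵀ} :=
    isClosed_eq continuous_const
      ((continuous_layerProdInv L).mul (continuous_layerProdInv L).matrix_transpose)
  -- The scales `e` range over a noncompact space, but the closed set is σ-compact, and so is its
  -- projection.
  obtain ⟨K, hK, hKU⟩ := (isSigmaCompact_univ.of_isClosed_subset hcl (Set.subset_univ _)).image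
    (continuous_fst)
  have : {Q : Fin L → Matrix.orthogonalGroup (Fin D) ℝ |
      ∃ e, S = layerProdInv L Q e * (layerProdInv L Q e)ᵀ} = ⋃ n, K n := by
    rw [hKU]
    ext Q
    simp
  rw [this]
  exact MeasurableSet.iUnion fun n => (hK n).isClosed.measurableSet

theorem pi_eq_zero_of_cons {α : Type*} [MeasurableSpace α] (μ : Measure α) [SigmaFinite μ] {L : ℕ}
    {B : Set (Fin (L + 1) → α)} (hB : MeasurableSet B)
    (h : ∀ Q' : Fin L → α, μ {q | Fin.cons (α := fun _ => α) q Q' ∈ B} = 0) :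
    (Measure.pi fun _ : Fin (L + 1) => μ) B = 0 := by
  have hmp := (measurePreserving_piFinSuccAbove (fun _ : Fin (L + 1) => μ) 0).symm
  rw [← hmp.measure_preimage hB.nullMeasurableSet, ← Measure.prod_swap,
    Measure.map_apply measurable_swap (hB.preimage hmp.measurable),
    Measure.measure_prod_null ((hB.preimage hmp.measurable).preimage measurable_swap)]
  refine Eventually.of_forall fun Q' => ?_
  refine Eq.trans (congrArg μ ?_) (h Q')
  ext q
  simp [MeasurableEquiv.piFinSuccAbove, Fin.insertNthEquiv]

/-- A covariance with simple spectrum is almost surely not produced by too few random layers. -/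
theorem pi_haarOrthogonal_exists_layerProdInv {S : Matrix (Fin D) (Fin D) ℝ} (hS : S.PosDef)
    (hinj : Function.Injective hS.isHermitian.eigenvalues) {L : ℕ}
    (hL : L * D < Fintype.card (UpperPairs D)) :
    (Measure.pi fun _ : Fin (L + 1) => haarOrthogonal D)
      {Q | ∃ e, S = layerProdInv (L + 1) Q e * (layerProdInv (L + 1) Q e)ᵀ} = 0 := by
  refine pi_eq_zero_of_cons _ (measurableSet_exists_layerProdInv (L + 1) S) fun Q' => ?_
  refine measure_mono_null ?_ (haarOrthogonal_corr_mem hS hinj (volume_layerCorrSet hL Q'))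
  rintro q ⟨e, he⟩
  have := corr_mem_layerCorrSet hS he
  simp only [Fin.cons_zero, Fin.cons_succ] at this
  exact this

theorem theorem1 (D : ℕ) (hD : 2 ≤ D) (S : Matrix (Fin D) (Fin D) ℝ) (hS : S.PosSemidef)
    (htrace : S.trace = D) (heig : Function.Injective hS.isHermitian.eigenvalues) (L : ℕ) :
    ∀ᵐ Q ∂(Measure.pi fun _ : Fin L => haarOrthogonal D),
      ExactlyRepresentable (multivariateGaussian 0 S) Q → ((D : ℝ) + 1) / 2 ≤ (L : ℝ) := by
  by_cases hL : ((D : ℝ) + 1) / 2 ≤ (L : ℝ)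
  · exact Eventually.of_forall fun _ _ => hL
  cases L with
  | zero =>
    refine Eventually.of_forall fun Q hQ => ?_
    obtain ⟨d, -, h⟩ := hQ.exists_layerProd_mul_mul_transpose hS
    -- The empty product forces `S = 1`, whose eigenvalues coincide; this is where `2 ≤ D` enters.
    have hS1 : S = 1 := by simpa [layerProd] using h
    have hone : ∀ i, hS.isHermitian.eigenvalues i = 1 := fun i => by
      have : Nontrivial (Matrix (Fin D) (Fin D) ℝ) := by
        have : Nonempty (Fin D) := ⟨i⟩
        infer_instance
      have hmem := hS.isHermitian.eigenvalues_mem_spectrum_real i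
      have hsp : spectrum ℝ S = {1} := by rw [hS1, spectrum.one_eq]
      rwa [hsp] at hmem
    have h01 : (⟨0, by omega⟩ : Fin D) = ⟨1, by omega⟩ :=
      heig ((hone _).trans (hone _).symm)
    simp at h01
  | succ L =>
    -- There are `L + 1` layers, so failure of the bound reads `2 L < D - 1`; multiply by `D / 2`.
    have hcard : L * D < Fintype.card (UpperPairs D) := by
      have h1 := card_upperPairs D
      have h2 : 2 * (L + 1) < D + 1 := by
        have : ((2 * (L + 1) : ℕ) : ℝ) < ((D + 1 : ℕ) : ℝ) := by
          push_cast at hL ⊢; linarith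
        exact_mod_cast this
      have h3 : L * 2 < D - 1 := by omega
      have h4 : D * (L * 2) < D * (D - 1) := by
        gcongr
      nlinarith
    by_cases hpd : S.PosDef
    · have h0 := pi_haarOrthogonal_exists_layerProdInv hpd heig hcard
      filter_upwards [measure_eq_zero_iff_ae_notMem.mp h0] with Q hQ hrep
      obtain ⟨d, hd, h⟩ := hrep.exists_layerProd_mul_mul_transpose hS
      exact absurd ⟨_, eq_layerProdInv_mul_transpose hd h⟩ hQ
    · refine Eventually.of_forall fun Q hrep => absurd ?_ hpd
      obtain ⟨d, -, h⟩ := hrep.exists_layerProd_mul_mul_transpose hS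
      rw [hS.posDef_iff_det_ne_zero]
      intro h0
      have := congrArg det h
      rw [det_mul, det_mul, h0, mul_zero, zero_mul, det_one] at this
      exact zero_ne_one this
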